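/- **Setting.** Let $\mathcal H_A,\mathcal H_B,\mathcal H_C$ be finite-dimensional Hilbert spaces, $\mathcal X$ a finite alphabet, and $\{p_X(x),\omega^x_{ABC}\}_{x\in\mathcal X}$ an ensemble of density operators on $\mathcal H_A\otimes\mathcal H_B\otimes\mathcal H_C$, with average $\omega_{ABC}=\sum_x p_X(x)\,\omega_{ABC}^x$ and extended classical-quantum state $\omega_{XABC}=\sum_x p_X(x)\,|x\rangle\langle x|\otimes\omega^x_{ABC}$. Logarithms are to base 2, and $\|M\|_1=\operatorname{Tr}\sqrt{M^\dagger M}$. **Codes.** A $(2^{nR_{1\to2}},2^{nR_{2\to3}},n)$ code for the cascade network Alice $\to$ Bob $\to$ Charlie consists of conditional distributions $p(m_1|x^n)$ and $p(m_2|m_1)$ with $m_1\in\{1,\dots,\lfloor 2^{nR_{1\to2}}\rfloor\}$, $m_2\in\{1,\dots,\lfloor 2^{nR_{2\to3}}\rfloor\}$, and of maps $\mathcal E$ from $\mathcal X$ to states of $A$, $\mathcal F$ from messages $m_1$ to states of $B^n$, and $\mathcal D$ from messages $m_2$ to states of $C^n$. With $X^n$ i.i.d. $\sim p_X$, $\rho_{A^n}^{x^n}=\bigotimes_i\mathcal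 E(x_i)$, $\rho^{m_1}_{B^n}=\mathcal F(m_1)$, $\rho^{m_2}_{C^n}=\mathcal D(m_2)$, the code induces the average state $$\overline\rho_{XABC}=\sum_{x^n,m_1,m_2}\Big(\prod_{j=1}^n p_X(x_j)\Big)\,p(m_1|x^n)\,p(m_2|m_1)\;\frac1n\sum_{i=1}^n|x_i\rangle\langle x_i|\otimes\rho_{A_i}^{x^n}\otimes\rho_{B_i}^{m_1}\otimes\rho_{C_i}^{m_2},$$ where $\rho_{A_i},\rho_{B_i},\rho_{C_i}$ are the reduced states of the $i$-th systems. A pair $(R_{1\to2},R_{2\to3})\in\mathbb R^2$ is achievable if for all $\varepsilon,\delta>0$ and all sufficiently large $n$ there is a $(2^{n(R_{1\to2}+\delta)},2^{n(R_{2\to3}+\delta)},n)$ code with $\|\overline\rho_{XABC}-\omega_{XABC}\|_1\le\varepsilon$. The capacity region $\mathcal C_{\mathrm{Cascade}}(\omega)$ is the closure of the set of achievable pairs. **Extensions.** Let $\mathscr S_{\mathrm{Cascade}}(\omega)$ be the set of all states $$\sigma_{XYZABC}=\sum_{x,y,z}p_{XYZ}(x,y,z)\,|x\rangle\langle x|\otimes|y\rangle\langle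 y|\otimes|z\rangle\langle z|\otimes\sigma_A^x\otimes\sigma_B^y\otimes\sigma_C^z$$ with finite alphabets $\mathcal Y,\mathcal Z$, a probability distribution $p_{XYZ}$ and density operators $\sigma_A^x,\sigma_B^y,\sigma_C^z$, such that $\sigma_{XABC}=\omega_{XABC}$. **Theorem (Cascade).** If $\mathscr S_{\mathrm{Cascade}}(\omega)\neq\emptyset$, then $$\mathcal C_{\mathrm{Cascade}}(\omega)=\bigcup_{\sigma\in\mathscr S_{\mathrm{Cascade}}(\omega)}\left\{(R_{1\to2},R_{2\to3})\in\mathbb R^2:\ R_{1\to2}\ge I(X;YZ)_\sigma,\ R_{2\to3}\ge I(X;Z)_\sigma\right\}.$$ If $\mathscr S_{\mathrm{Cascade}}(\omega)=\emptyset$, then coordination is impossible: no pair $(R_{1\to2},R_{2\to3})$ is achievable. -/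

import Mathlib

open scoped Kronecker ComplexOrder

namespace EmpiricalCoordination

noncomputable section

/-! ### States, distances, entropies

A finite-dimensional quantum system with a fixed orthonormal basis indexed by `ι` has Hilbert space
`ℂ^ι`; operators are matrices, a joint system has the product index set, and the `n`-fold tensor
power has index set `Fin n → ι`. -/

/-- Density operators: positive semidefinite matrices of unit trace. -/
def State (ι : Type*) [Fintype ι] : Type _ :=
  {ρ : Matrix ι ι ℂ // ρ.PosSemidef ∧ ρ.trace = 1}

/-- Trace norm `‖M‖₁ = Tr √(Mᴴ M)`, the sum of the singular values of `M`. -/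
def traceNorm {ι : Type*} [Fintype ι] [DecidableEq ι] (M : Matrix ι ι ℂ) : ℝ :=
  ∑ i, √((Matrix.isHermitian_conjTranspose_mul_self M).eigenvalues i)

/-- The rank-one projection `|x⟩⟨x|` on a classical register. -/
def ketbra {X : Type*} [DecidableEq X] (x : X) : Matrix X X ℂ :=
  Matrix.single x x 1

/-- Product operator `ρ₁ ⊗ ⋯ ⊗ ρₙ`. -/
def tensorProd {ι : Type*} {n : ℕ} (ρ : Fin n → Matrix ι ι ℂ) :
    Matrix (Fin n → ι) (Fin n → ι) ℂ :=
  Matrix.of fun f g => ∏ j, ρ j (f j) (g j)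

/-- Reduced operator on the `i`-th of `n` systems (partial trace over all the others). -/
def reduced {ι : Type*} [Fintype ι] [DecidableEq ι] {n : ℕ}
    (ρ : Matrix (Fin n → ι) (Fin n → ι) ℂ) (i : Fin n) : Matrix ι ι ℂ :=
  Matrix.of fun b b' => ∑ f : Fin n → ι, if f i = b then ρ f (Function.update f i b') else 0

/-- Shannon entropy, in bits. -/
def entropy {U : Type*} [Fintype U] (q : U → ℝ) : ℝ :=
  (∑ u, Real.negMulLog (q u)) / Real.log 2

/-- Mutual information `I(U;V) = H(U) + H(V) - H(UV)` of a joint probability mass function. -/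
def mutualInfo {U V : Type*} [Fintype U] [Fintype V] (q : U × V → ℝ) : ℝ :=
  entropy (fun u => ∑ v, q (u, v)) + entropy (fun v => ∑ u, q (u, v)) - entropy q

section Cascade

variable {𝒳 α β γ : Type*} [Fintype 𝒳] [DecidableEq 𝒳] [Fintype α] [DecidableEq α]
  [Fintype β] [DecidableEq β] [Fintype γ] [DecidableEq γ]

/-- The extended c-q state `ω_{XABC} = ∑ₓ p(x) |x⟩⟨x| ⊗ ω_{ABC}^x`. -/
def extendedState (p : stdSimplex ℝ 𝒳) (ω : 𝒳 → State (α × β × γ)) :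
    Matrix (𝒳 × α × β × γ) (𝒳 × α × β × γ) ℂ :=
  ∑ x, (p.1 x : ℂ) • (ketbra x ⊗ₖ (ω x).1)

/-! ### Codes for the cascade network -/

variable (𝒳 α β γ) in
/-- An empirical coordination code of block length `n` for the cascade network, with message sets
`[M₁]` (Alice to Bob) and `[M₂]` (Bob to Charlie). -/
structure CascadeCode (M₁ M₂ n : ℕ) where
  /-- Alice's random choice of message, `p(m₁ | xⁿ)`. -/
  alice : (Fin n → 𝒳) → stdSimplex ℝ (Fin M₁)
  /-- Bob's random choice of message, `p(m₂ | m₁)`. -/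
  bob : Fin M₁ → stdSimplex ℝ (Fin M₂)
  /-- Alice's c-q encoding channel, applied letter by letter. -/
  encA : 𝒳 → State α
  /-- Bob's c-q channel, preparing `Bⁿ`. -/
  encB : Fin M₁ → State (Fin n → β)
  /-- Charlie's c-q channel, preparing `Cⁿ`. -/
  encC : Fin M₂ → State (Fin n → γ)

/-- The average joint state, over the `n` positions, of source letter and quantum systems:
`∑ p(xⁿ) p(m₁|xⁿ) p(m₂|m₁) (1/n) ∑ᵢ |xᵢ⟩⟨xᵢ| ⊗ ρ_{Aᵢ}^{xⁿ} ⊗ ρ_{Bᵢ}^{m₁} ⊗ ρ_{Cᵢ}^{m₂}`. -/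
def CascadeCode.averageState {M₁ M₂ n : ℕ} (c : CascadeCode 𝒳 α β γ M₁ M₂ n)
    (p : stdSimplex ℝ 𝒳) : Matrix (𝒳 × α × β × γ) (𝒳 × α × β × γ) ℂ :=
  ∑ x : Fin n → 𝒳, ∑ m₁ : Fin M₁, ∑ m₂ : Fin M₂,
    (((∏ j, p.1 (x j)) * (c.alice x).1 m₁ * (c.bob m₁).1 m₂ : ℝ) : ℂ) •
      ((n : ℂ)⁻¹ • ∑ i : Fin n,
        ketbra (x i) ⊗ₖ
          (reduced (tensorProd fun j => (c.encA (x j)).1) i ⊗ₖ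
            (reduced (c.encB m₁).1 i ⊗ₖ reduced (c.encC m₂).1 i)))

/-- `(R₁₂, R₂₃)` is achievable if for all `ε, δ > 0` and all large `n` there is a
`(2^{n(R₁₂+δ)}, 2^{n(R₂₃+δ)}, n)` code whose average joint state is `ε`-close to `ω_{XABC}`.
The message sets are `{1, …, ⌊2^{n(R+δ)}⌋}`. -/
def Achievable (p : stdSimplex ℝ 𝒳) (ω : 𝒳 → State (α × β × γ)) (R : ℝ × ℝ) : Prop :=
  ∀ ε > (0 : ℝ), ∀ δ > (0 : ℝ), ∃ N : ℕ, ∀ n ≥ N,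
    ∃ c : CascadeCode 𝒳 α β γ ⌊(2 : ℝ) ^ ((n : ℝ) * (R.1 + δ))⌋₊
        ⌊(2 : ℝ) ^ ((n : ℝ) * (R.2 + δ))⌋₊ n,
      traceNorm (c.averageState p - extendedState p ω) ≤ ε

/-- The capacity region: the closure of the set of achievable rate pairs. -/
def capacityRegion (p : stdSimplex ℝ 𝒳) (ω : 𝒳 → State (α × β × γ)) : Set (ℝ × ℝ) :=
  closure {R | Achievable p ω R}

/-! ### The single-letter region -/

variable (𝒳 α β γ) in
/-- The data of a c-q state `σ_{XYZABC}` of product form, with finite alphabets `𝒴 = [cardY]` and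
`𝒵 = [cardZ]`. -/
structure ProductExtension where
  cardY : ℕ
  cardZ : ℕ
  /-- The joint distribution `p_{XYZ}`. -/
  pXYZ : stdSimplex ℝ (𝒳 × Fin cardY × Fin cardZ)
  stateA : 𝒳 → State α
  stateB : Fin cardY → State β
  stateC : Fin cardZ → State γ

/-- `σ_{XYZABC} = ∑ p(x,y,z) |x⟩⟨x| ⊗ |y⟩⟨y| ⊗ |z⟩⟨z| ⊗ σ_A^x ⊗ σ_B^y ⊗ σ_C^z`. -/
def ProductExtension.cqState (σ : ProductExtension 𝒳 α β γ) :
    Matrix (𝒳 × Fin σ.cardY × Fin σ.cardZ × α × β × γ)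
      (𝒳 × Fin σ.cardY × Fin σ.cardZ × α × β × γ) ℂ :=
  ∑ x : 𝒳, ∑ y : Fin σ.cardY, ∑ z : Fin σ.cardZ,
    (σ.pXYZ.1 (x, y, z) : ℂ) •
      (ketbra x ⊗ₖ (ketbra y ⊗ₖ (ketbra z ⊗ₖ
        ((σ.stateA x).1 ⊗ₖ ((σ.stateB y).1 ⊗ₖ (σ.stateC z).1)))))

/-- Partial trace over the registers `Y` and `Z`. -/
def traceYZ {Y Z : Type*} [Fintype Y] [Fintype Z]
    (M : Matrix (𝒳 × Y × Z × α × β × γ) (𝒳 × Y × Z × α × β × γ) ℂ) :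
    Matrix (𝒳 × α × β × γ) (𝒳 × α × β × γ) ℂ :=
  Matrix.of fun s t => ∑ y : Y, ∑ z : Z, M (s.1, y, z, s.2) (t.1, y, z, t.2)

/-- The set of product-form c-q extensions with `σ_{XABC} = ω_{XABC}`. -/
def cascadeExtensions (p : stdSimplex ℝ 𝒳) (ω : 𝒳 → State (α × β × γ)) :
    Set (ProductExtension 𝒳 α β γ) :=
  {σ | traceYZ σ.cqState = extendedState p ω}

/-- `I(X;YZ)_σ`. -/
def ProductExtension.infoXYZ (σ : ProductExtension 𝒳 α β γ) : ℝ :=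
  mutualInfo σ.pXYZ.1

/-- `I(X;Z)_σ`. -/
def ProductExtension.infoXZ (σ : ProductExtension 𝒳 α β γ) : ℝ :=
  mutualInfo fun s : 𝒳 × Fin σ.cardZ => ∑ y, σ.pXYZ.1 (s.1, y, s.2)

end Cascade

end

end EmpiricalCoordination

/-!
The theorem is proved in two halves, both in terms of the entropy `natEntropy` in nats.

*Achievability* (`achievable_of_mem_cascadeExtensions`). Factorize the law of an extension as
`s(z) V(y|z) W(x|y,z)`. Draw a superposition codebook: cloud centres `zⁿ(m₂)` from `s` and, around
each of them, satellites `yⁿ(m₂, m')` from `V`. If the clouds have rate above `I(X;Z)` and all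
codewords together have rate above `I(X;YZ)`, then a uniformly chosen codeword sent through the
reverse channel `W` produces nearly the i.i.d. source law (superposition soft covering,
`exists_codebook`): the second moment of the typical part of the output law splits into
contributions of equal codewords, of equal clouds, and of independent clouds. Alice therefore
encodes with the posterior of the codeword given the source word, Bob forwards the index of the
cloud, and the joint law of source and codeword is close to that of the reverse channel, whose
average joint type is `p_{XYZ}` up to `O(1/√n)`. Only the *average* joint type matters, because the
average state depends linearly on it.

*Converse* (`exists_extension_of_mem_capacityRegion`). With `Y = (M₁, I)` and `Z = (M₂, I)` for a
uniform position `I`, a code yields a product extension of its own average state whose informations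
are bounded by the rates (`card_mul_natEntropy_sub_le`, a single application of `log t ≤ t - 1`).
Passing to the limit needs compactness although the alphabets of `Y` and `Z` are unbounded. So
extensions are recorded only through the data that matter, namely the `X`-marginal, the operators
`∑ p(x,y,z) σ_B^y ⊗ σ_C^z` and the two conditional entropies. These data form the convex hull of
single-`z` contributions, each built from a point of the convex hull of single-`y` contributions;
both hulls are compact by Carathéodory's theorem (`isCompact_convexHull_charlieSet`), and every
point of the outer hull comes from an extension with finite alphabets
(`exists_of_mem_convexHull_charlieSet`).
-/

namespace EmpiricalCoordination

noncomputable section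

/-! ### Finite probability -/

lemma sum_prod_eq_prod_sum {ι X R : Type*} [Fintype ι] [DecidableEq ι] [Fintype X]
    [CommSemiring R] (f : ι → X → R) : ∑ x : ι → X, ∏ i, f i (x i) = ∏ i, ∑ a, f i a := by
  rw [Finset.prod_univ_sum, Fintype.piFinset_univ]

/-- Expectation, under a product law, of a function of one coordinate. -/
lemma sum_prod_mul_apply {ι X : Type*} [Fintype ι] [DecidableEq ι] [Fintype X]
    (p : ι → X → ℝ) (hp : ∀ i, ∑ a, p i a = 1) (i : ι) (f : X → ℝ) :
    ∑ x : ι → X, (∏ j, p j (x j)) * f (x i) = ∑ a, p i a * f a := by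
  have h : ∀ x : ι → X, (∏ j, p j (x j)) * f (x i)
      = ∏ j, p j (x j) * (if j = i then f (x j) else 1) := by
    intro x
    rw [Finset.prod_mul_distrib]
    simp
  simp_rw [h]
  rw [sum_prod_eq_prod_sum fun j a => p j a * (if j = i then f a else 1)]
  rw [Finset.prod_eq_single i]
  · simp
  · intro j _ hj
    simp [hj, hp]
  · simp

/-- Two distinct coordinates are independent under a product law. -/
lemma sum_prod_mul_apply_mul_apply {ι X : Type*} [Fintype ι] [DecidableEq ι] [Fintype X]
    (p : ι → X → ℝ) (hp : ∀ i, ∑ a, p i a = 1) {i k : ι} (hik : i ≠ k) (f g : X → ℝ) :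
    ∑ x : ι → X, (∏ j, p j (x j)) * (f (x i) * g (x k))
      = (∑ a, p i a * f a) * ∑ a, p k a * g a := by
  have h : ∀ x : ι → X, (∏ j, p j (x j)) * (f (x i) * g (x k))
      = ∏ j, p j (x j) * ((if j = i then f (x j) else 1) * (if j = k then g (x j) else 1)) := by
    intro x
    rw [Finset.prod_mul_distrib, Finset.prod_mul_distrib]
    simp
  simp_rw [h]
  rw [sum_prod_eq_prod_sum fun j a =>
    p j a * ((if j = i then f a else 1) * (if j = k then g a else 1))]
  rw [← Finset.mul_prod_erase _ _ (Finset.mem_univ i),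
    ← Finset.mul_prod_erase _ _ (Finset.mem_erase.2 ⟨hik.symm, Finset.mem_univ k⟩)]
  rw [Finset.prod_eq_one, mul_one]
  · congr 1
    · simp [hik]
    · simp [hik.symm]
  · intro j hj
    simp only [Finset.mem_erase, Finset.mem_univ, and_true] at hj
    simp [hj.1, hj.2, hp]

/-- The product of probability mass functions is one. -/
lemma prod_mem_stdSimplex {ι X : Type*} [Fintype ι] [DecidableEq ι] [Fintype X]
    {p : ι → X → ℝ} (hp : ∀ i, p i ∈ stdSimplex ℝ X) :
    (fun x : ι → X => ∏ i, p i (x i)) ∈ stdSimplex ℝ (ι → X) := by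
  refine ⟨fun x => Finset.prod_nonneg fun i _ => (hp i).1 _, ?_⟩
  rw [sum_prod_eq_prod_sum]
  simp [fun i => (hp i).2]

/-- Variance of a sum of i.i.d. centred variables. -/
lemma sum_prod_mul_sq_of_centred {ι X : Type*} [Fintype ι] [DecidableEq ι] [Fintype X]
    (p : X → ℝ) (hp : ∑ a, p a = 1) (g : X → ℝ) (hg : ∑ a, p a * g a = 0) :
    ∑ x : ι → X, (∏ j, p (x j)) * (∑ i, g (x i)) ^ 2
      = Fintype.card ι * ∑ a, p a * g a ^ 2 := by
  simp_rw [sq (∑ i, _), Finset.sum_mul_sum, Finset.mul_sum]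
  rw [Finset.sum_comm]
  have h : ∀ i : ι, ∑ x : ι → X, ∑ k, (∏ j, p (x j)) * (g (x i) * g (x k))
      = ∑ a, p a * g a ^ 2 := by
    intro i
    rw [Finset.sum_comm, Finset.sum_eq_single i]
    · rw [← sum_prod_mul_apply (fun _ => p) (fun _ => hp) i (fun a => g a ^ 2)]
      simp_rw [sq]
    · intro k _ hk
      rw [sum_prod_mul_apply_mul_apply (fun _ => p) (fun _ => hp) (Ne.symm hk) g g, hg, zero_mul]
    · simp
  rw [Finset.sum_congr rfl fun i _ => h i]
  simp [Finset.mul_sum]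

lemma sum_mul_sub_sq {X : Type*} [Fintype X] (p : X → ℝ) (hp : ∑ a, p a = 1) (f : X → ℝ) :
    ∑ a, p a * (f a - ∑ b, p b * f b) ^ 2 = ∑ a, p a * f a ^ 2 - (∑ b, p b * f b) ^ 2 := by
  set μ := ∑ b, p b * f b with hμ
  have : ∀ a, p a * (f a - μ) ^ 2 = p a * f a ^ 2 - 2 * μ * (p a * f a) + μ ^ 2 * p a := by
    intro a; ring
  simp_rw [this, Finset.sum_add_distrib, Finset.sum_sub_distrib, ← Finset.mul_sum, hp, ← hμ]
  ring

/-- Variance of an i.i.d. sample mean, bounded by the second moment. -/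
lemma sum_prod_mul_mean_sub_sq_le {ι X : Type*} [Fintype ι] [DecidableEq ι] [Nonempty ι]
    [Fintype X] (p : X → ℝ) (hp : ∑ a, p a = 1) (f : X → ℝ) :
    ∑ x : ι → X, (∏ j, p (x j)) * ((Fintype.card ι : ℝ)⁻¹ * ∑ i, f (x i) - ∑ a, p a * f a) ^ 2
      ≤ (∑ a, p a * f a ^ 2) / Fintype.card ι := by
  set μ := ∑ a, p a * f a with hμ
  have hc : (Fintype.card ι : ℝ) ≠ 0 := by positivity
  have h0 : ∑ a, p a * (f a - μ) = 0 := by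
    simp_rw [mul_sub, Finset.sum_sub_distrib, ← Finset.sum_mul, hp]; linarith
  have h1 := sum_prod_mul_sq_of_centred (ι := ι) p hp (fun a => f a - μ) h0
  have h2 : ∀ x : ι → X, (∏ j, p (x j)) * ((Fintype.card ι : ℝ)⁻¹ * ∑ i, f (x i) - μ) ^ 2
      = ((Fintype.card ι : ℝ)⁻¹) ^ 2 * ((∏ j, p (x j)) * (∑ i, (f (x i) - μ)) ^ 2) := by
    intro x
    rw [Finset.sum_sub_distrib]
    simp only [Finset.sum_const, Finset.card_univ, nsmul_eq_mul]
    field_simp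
  have hv := sum_mul_sub_sq p hp f
  rw [← hμ] at hv
  simp_rw [h2, ← Finset.mul_sum, h1, hv]
  rw [div_eq_inv_mul, sq, mul_assoc, ← mul_assoc _ (Fintype.card ι : ℝ), inv_mul_cancel₀ hc,
    one_mul]
  gcongr
  nlinarith [sq_nonneg μ]

/-- Second moment of an i.i.d. sample mean. -/
lemma sum_prod_mul_mean_sq_le {ι X : Type*} [Fintype ι] [DecidableEq ι] [Nonempty ι]
    [Fintype X] (p : X → ℝ) (hp : ∑ a, p a = 1) (f : X → ℝ) :
    ∑ x : ι → X, (∏ j, p (x j)) * ((Fintype.card ι : ℝ)⁻¹ * ∑ i, f (x i)) ^ 2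
      ≤ (∑ a, p a * f a ^ 2) / Fintype.card ι + (∑ a, p a * f a) ^ 2 := by
  have hmean : ∑ x : ι → X, (∏ j, p (x j)) * ((Fintype.card ι : ℝ)⁻¹ * ∑ i, f (x i))
      = ∑ a, p a * f a := by
    simp_rw [Finset.mul_sum]
    rw [Finset.sum_comm]
    have : ∀ i : ι, ∑ x : ι → X, (∏ j, p (x j)) * ((Fintype.card ι : ℝ)⁻¹ * f (x i))
        = (Fintype.card ι : ℝ)⁻¹ * ∑ a, p a * f a := by
      intro i
      rw [sum_prod_mul_apply (fun _ => p) (fun _ => hp) i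
        (fun a => (Fintype.card ι : ℝ)⁻¹ * f a), Finset.mul_sum]
      exact Finset.sum_congr rfl fun a _ => by ring
    rw [Finset.sum_congr rfl fun i _ => this i]
    have hc : (Fintype.card ι : ℝ) ≠ 0 := by positivity
    simp [hc]
  have hone : ∑ x : ι → X, ∏ j, p (x j) = 1 := by
    rw [sum_prod_eq_prod_sum fun _ => p]; simp [hp]
  have h := sum_mul_sub_sq _ hone fun x : ι → X => (Fintype.card ι : ℝ)⁻¹ * ∑ i, f (x i)
  rw [hmean] at h
  have := sum_prod_mul_mean_sub_sq_le (ι := ι) p hp f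
  linarith

lemma sum_mul_abs_le_sqrt {X : Type*} [Fintype X] {p : X → ℝ} (hp : p ∈ stdSimplex ℝ X)
    (f : X → ℝ) : ∑ a, p a * |f a| ≤ √(∑ a, p a * f a ^ 2) := by
  apply Real.le_sqrt_of_sq_le
  have := sum_mul_sub_sq p hp.2 fun a => |f a|
  have h0 : 0 ≤ ∑ a, p a * (|f a| - ∑ b, p b * |f b|) ^ 2 :=
    Finset.sum_nonneg fun a _ => mul_nonneg (hp.1 a) (sq_nonneg _)
  simp_rw [sq_abs] at this
  linarith

/-- A value at most the mean is attained. -/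
lemma exists_le_of_sum_mul_le {X : Type*} [Fintype X] {p : X → ℝ} (hp : p ∈ stdSimplex ℝ X)
    {f : X → ℝ} {b : ℝ} (h : ∑ a, p a * f a ≤ b) : ∃ a, f a ≤ b := by
  by_contra! hc
  have h1 : ∑ a, p a * (f a - b) ≤ 0 := by
    simp_rw [mul_sub, Finset.sum_sub_distrib, ← Finset.sum_mul, hp.2]; linarith
  have h2 : ∀ a ∈ Finset.univ, 0 ≤ p a * (f a - b) := fun a _ =>
    mul_nonneg (hp.1 a) (by linarith [hc a])
  have h3 := (Finset.sum_eq_zero_iff_of_nonneg h2).1 (le_antisymm h1 (Finset.sum_nonneg h2))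
  have h4 : ∀ a, p a = 0 := fun a => by
    have := h3 a (Finset.mem_univ a)
    rcases mul_eq_zero.1 this with h | h
    · exact h
    · linarith [hc a]
  have := hp.2
  simp [h4] at this

/-- A joint weight on `U × V` disintegrates along its second marginal; the fibres of zero mass get
an arbitrary law. -/
lemma exists_kernel {U V : Type*} [Fintype U] [Nonempty U] (q : U → V → ℝ)
    (hq : ∀ u v, 0 ≤ q u v) :
    ∃ K : V → U → ℝ, (∀ v, K v ∈ stdSimplex ℝ U) ∧ ∀ u v, q u v = (∑ u', q u' v) * K v u := by
  classical
  obtain ⟨u₀⟩ := ‹Nonempty U›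
  refine ⟨fun v => if (∑ u', q u' v) = 0 then Pi.single u₀ 1 else
    fun u => q u v / ∑ u', q u' v, fun v => ?_, fun u v => ?_⟩
  · dsimp only
    split_ifs with h
    · exact single_mem_stdSimplex ℝ u₀
    · refine ⟨fun u => div_nonneg (hq u v) (Finset.sum_nonneg fun _ _ => hq _ _), ?_⟩
      rw [← Finset.sum_div, div_self h]
  · dsimp only
    split_ifs with h
    · rw [h, zero_mul]
      exact (Finset.sum_eq_zero_iff_of_nonneg fun u' _ => hq u' v).1 h u (Finset.mem_univ u)
    · field_simp

/-! ### Superposition soft covering -/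

section SoftCovering

variable {ι κ X Y Z : Type*} [Fintype ι] [DecidableEq ι] [Nonempty ι] [Fintype κ] [DecidableEq κ]
  [Nonempty κ] [Fintype X] [Fintype Y] [Fintype Z]

/-- Law of a cluster of a random superposition codebook: a cloud centre `z` drawn from `s` and,
given `z`, independent satellites drawn from `V z`. -/
def clusterLaw (s : Z → ℝ) (V : Z → Y → ℝ) (d : Z × (κ → Y)) : ℝ :=
  s d.1 * ∏ k, V d.1 (d.2 k)

/-- Average of `f` over the codewords of a superposition codebook. -/
def codebookAvg (c : ι → Z × (κ → Y)) (f : Z → Y → ℝ) : ℝ :=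
  (Fintype.card ι : ℝ)⁻¹ * ∑ i, (Fintype.card κ : ℝ)⁻¹ * ∑ k, f (c i).1 ((c i).2 k)

lemma clusterLaw_mem {κ Y Z : Type*} [Fintype κ] [DecidableEq κ] [Fintype Y] [Fintype Z]
    {s : Z → ℝ} {V : Z → Y → ℝ} (hs : s ∈ stdSimplex ℝ Z) (hV : ∀ z, V z ∈ stdSimplex ℝ Y) :
    (clusterLaw (κ := κ) s V) ∈ stdSimplex ℝ (Z × (κ → Y)) := by
  refine ⟨fun d => mul_nonneg (hs.1 _) (Finset.prod_nonneg fun k _ => (hV _).1 _), ?_⟩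
  unfold clusterLaw
  rw [Fintype.sum_prod_type]
  have h : ∀ z, ∑ y : κ → Y, s z * ∏ k, V z (y k) = s z := fun z => by
    rw [← Finset.mul_sum, (prod_mem_stdSimplex (ι := κ) fun _ => hV z).2, mul_one]
  simp only [h, hs.2]

lemma sum_clusterLaw_mul_mean {s : Z → ℝ} {V : Z → Y → ℝ}
    (hV : ∀ z, V z ∈ stdSimplex ℝ Y) (f : Z → Y → ℝ) :
    ∑ d : Z × (κ → Y), clusterLaw s V d * ((Fintype.card κ : ℝ)⁻¹ * ∑ k, f d.1 (d.2 k))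
      = ∑ z, s z * ∑ y, V z y * f z y := by
  unfold clusterLaw
  rw [Fintype.sum_prod_type]
  refine Finset.sum_congr rfl fun z _ => ?_
  simp_rw [mul_assoc, ← Finset.mul_sum]
  congr 1
  simp_rw [Finset.mul_sum]
  rw [Finset.sum_comm]
  have h : ∀ k : κ, ∑ y : κ → Y, (∏ j, V z (y j)) * ((Fintype.card κ : ℝ)⁻¹ * f z (y k))
      = (Fintype.card κ : ℝ)⁻¹ * ∑ y, V z y * f z y := fun k => by
    rw [sum_prod_mul_apply (fun _ => V z) (fun _ => (hV z).2) k
      (fun a => (Fintype.card κ : ℝ)⁻¹ * f z a), Finset.mul_sum]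
    exact Finset.sum_congr rfl fun a _ => by ring
  rw [Finset.sum_congr rfl fun k _ => h k]
  have hc : (Fintype.card κ : ℝ) ≠ 0 := by positivity
  simp [hc]

lemma sum_clusterLaw_mul_mean_sq_le {s : Z → ℝ} {V : Z → Y → ℝ} (hs : s ∈ stdSimplex ℝ Z)
    (hV : ∀ z, V z ∈ stdSimplex ℝ Y) (f : Z → Y → ℝ) :
    ∑ d : Z × (κ → Y), clusterLaw s V d * ((Fintype.card κ : ℝ)⁻¹ * ∑ k, f d.1 (d.2 k)) ^ 2
      ≤ (∑ z, s z * ∑ y, V z y * f z y ^ 2) / Fintype.card κ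
        + ∑ z, s z * (∑ y, V z y * f z y) ^ 2 := by
  unfold clusterLaw
  rw [Fintype.sum_prod_type, Finset.sum_div, ← Finset.sum_add_distrib]
  refine Finset.sum_le_sum fun z _ => ?_
  simp_rw [mul_assoc, ← Finset.mul_sum]
  rw [mul_div_assoc, ← mul_add]
  exact mul_le_mul_of_nonneg_left (sum_prod_mul_mean_sq_le (V z) (hV z).2 (f z)) (hs.1 z)

lemma sum_mul_codebookAvg {s : Z → ℝ} {V : Z → Y → ℝ} (hs : s ∈ stdSimplex ℝ Z)
    (hV : ∀ z, V z ∈ stdSimplex ℝ Y) (f : Z → Y → ℝ) :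
    ∑ c : ι → Z × (κ → Y), (∏ i, clusterLaw s V (c i)) * codebookAvg c f
      = ∑ z, s z * ∑ y, V z y * f z y := by
  unfold codebookAvg
  simp_rw [Finset.mul_sum (s := (Finset.univ : Finset ι))]
  rw [Finset.sum_comm]
  set F : Z × (κ → Y) → ℝ := fun d => (Fintype.card κ : ℝ)⁻¹ * ∑ k, f d.1 (d.2 k) with hF
  have h : ∀ i : ι, ∑ c : ι → Z × (κ → Y), (∏ j, clusterLaw s V (c j)) *
      ((Fintype.card ι : ℝ)⁻¹ * ((Fintype.card κ : ℝ)⁻¹ * ∑ k, f (c i).1 ((c i).2 k)))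
      = (Fintype.card ι : ℝ)⁻¹ * ∑ z, s z * ∑ y, V z y * f z y := fun i => by
    rw [sum_prod_mul_apply (fun _ => clusterLaw s V) (fun _ => (clusterLaw_mem hs hV).2) i
      (fun d => (Fintype.card ι : ℝ)⁻¹ * F d), ← sum_clusterLaw_mul_mean (κ := κ) hV,
      Finset.mul_sum]
    exact Finset.sum_congr rfl fun a _ => by ring
  rw [Finset.sum_congr rfl fun k _ => h k]
  have hc : (Fintype.card ι : ℝ) ≠ 0 := by positivity
  simp [hc]

/-- Mean deviation of a codebook average: distinct clusters are independent, and within a cluster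
only the cloud centre is shared. -/
lemma sum_mul_abs_codebookAvg_sub_le {s : Z → ℝ} {V : Z → Y → ℝ} (hs : s ∈ stdSimplex ℝ Z)
    (hV : ∀ z, V z ∈ stdSimplex ℝ Y) (f : Z → Y → ℝ) :
    ∑ c : ι → Z × (κ → Y), (∏ i, clusterLaw s V (c i)) *
        |codebookAvg c f - ∑ z, s z * ∑ y, V z y * f z y|
      ≤ √(((∑ z, s z * ∑ y, V z y * f z y ^ 2) / Fintype.card κ
        + ∑ z, s z * (∑ y, V z y * f z y) ^ 2) / Fintype.card ι) := by
  refine (sum_mul_abs_le_sqrt (prod_mem_stdSimplex fun _ => clusterLaw_mem hs hV) _).trans ?_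
  apply Real.sqrt_le_sqrt
  have h := sum_prod_mul_mean_sub_sq_le (ι := ι) (clusterLaw (κ := κ) s V)
    (clusterLaw_mem hs hV).2 (fun d => (Fintype.card κ : ℝ)⁻¹ * ∑ k, f d.1 (d.2 k))
  rw [sum_clusterLaw_mul_mean hV] at h
  refine h.trans ?_
  gcongr
  exact sum_clusterLaw_mul_mean_sq_le hs hV f

lemma codebookAvg_mono {ι κ Y Z : Type*} [Fintype ι] [Fintype κ] (c : ι → Z × (κ → Y))
    {f g : Z → Y → ℝ} (h : ∀ z y, f z y ≤ g z y) :
    codebookAvg c f ≤ codebookAvg c g := by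
  unfold codebookAvg
  gcongr
  exact h _ _

lemma codebookAvg_add {ι κ Y Z : Type*} [Fintype ι] [Fintype κ] (c : ι → Z × (κ → Y))
    (f g : Z → Y → ℝ) :
    codebookAvg c (fun z y => f z y + g z y) = codebookAvg c f + codebookAvg c g := by
  unfold codebookAvg
  simp_rw [Finset.sum_add_distrib, mul_add, Finset.sum_add_distrib, mul_add]

/-- One-shot superposition soft covering. Some codebook makes the channel output law close to the
marginal `p` and, simultaneously, keeps the average of a nonnegative cost `h` small. Here `g` is the
part of the channel `W` on the typical set, where the likelihood ratios against `p` of the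
satellite channel and of the cloud channel are at most `A` and `B`. -/
theorem exists_codebook {s : Z → ℝ} {V : Z → Y → ℝ} {W g : Z → Y → X → ℝ} {p : X → ℝ}
    (hs : s ∈ stdSimplex ℝ Z) (hV : ∀ z, V z ∈ stdSimplex ℝ Y)
    (hp : p ∈ stdSimplex ℝ X)
    (hpW : ∀ x, p x = ∑ z, s z * ∑ y, V z y * W z y x)
    (hg0 : ∀ z y x, 0 ≤ g z y x) (hgW : ∀ z y x, g z y x ≤ W z y x)
    {A B : ℝ} (hA : 0 ≤ A) (hB : 0 ≤ B) (hgA : ∀ z y x, g z y x ≤ A * p x)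
    (hgB : ∀ z x, ∑ y, V z y * g z y x ≤ B * p x) (h : Z → Y → ℝ) :
    ∃ c : ι → Z × (κ → Y),
      ∑ x, |codebookAvg c (fun z y => W z y x) - p x| + codebookAvg c h
        ≤ √((A / Fintype.card κ + B) / Fintype.card ι)
          + 2 * ∑ x, ∑ z, s z * ∑ y, V z y * (W z y x - g z y x)
          + ∑ z, s z * ∑ y, V z y * h z y := by
  have hpi := prod_mem_stdSimplex (ι := ι) fun _ => clusterLaw_mem (κ := κ) hs hV
  refine exists_le_of_sum_mul_le hpi ?_
  simp_rw [mul_add, Finset.sum_add_distrib]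
  rw [sum_mul_codebookAvg hs hV]
  gcongr ?_ + _
  simp_rw [Finset.mul_sum (s := (Finset.univ : Finset X))]
  rw [Finset.sum_comm]
  have hsq : √((A / Fintype.card κ + B) / Fintype.card ι)
      = ∑ x, √((A / Fintype.card κ + B) / Fintype.card ι) * p x := by
    rw [← Finset.mul_sum, hp.2, mul_one]
  rw [hsq, ← Finset.sum_add_distrib]
  refine Finset.sum_le_sum fun x _ => ?_
  set μg := ∑ z, s z * ∑ y, V z y * g z y x with hμg
  set μb := ∑ z, s z * ∑ y, V z y * (W z y x - g z y x) with hμb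
  have hpx : p x = μg + μb := by
    rw [hpW, hμg, hμb, ← Finset.sum_add_distrib]
    refine Finset.sum_congr rfl fun z _ => ?_
    rw [← mul_add, ← Finset.sum_add_distrib]
    exact congrArg _ (Finset.sum_congr rfl fun y _ => by ring)
  have hμb0 : 0 ≤ μb := Finset.sum_nonneg fun z _ => mul_nonneg (hs.1 z) <|
    Finset.sum_nonneg fun y _ => mul_nonneg ((hV z).1 y) (by linarith [hgW z y x])
  have hμg0 : 0 ≤ μg := Finset.sum_nonneg fun z _ => mul_nonneg (hs.1 z) <|
    Finset.sum_nonneg fun y _ => mul_nonneg ((hV z).1 y) (hg0 z y x)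
  -- only the typical part `g` needs a second moment; the atypical part enters through its mean
  have hpt : ∀ c : ι → Z × (κ → Y), |codebookAvg c (fun z y => W z y x) - p x|
      ≤ |codebookAvg c (fun z y => g z y x) - μg|
        + codebookAvg c (fun z y => W z y x - g z y x) + μb := fun c => by
    have h1 : codebookAvg c (fun z y => W z y x) = codebookAvg c (fun z y => g z y x)
        + codebookAvg c (fun z y => W z y x - g z y x) := by
      rw [← codebookAvg_add]; congr 1; ext z y; ring
    have h2 : 0 ≤ codebookAvg c (fun z y => W z y x - g z y x) := by
      have := codebookAvg_mono c (f := fun _ _ => 0) (g := fun z y => W z y x - g z y x)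
        fun z y => by linarith [hgW z y x]
      simpa [codebookAvg] using this
    rw [h1, hpx, abs_le]
    have h3 := abs_le.1 (le_refl |codebookAvg c (fun z y => g z y x) - μg|)
    constructor <;> linarith [h3.1, h3.2]
  calc ∑ c : ι → Z × (κ → Y), (∏ i, clusterLaw s V (c i)) *
        |codebookAvg c (fun z y => W z y x) - p x|
      ≤ ∑ c : ι → Z × (κ → Y), (∏ i, clusterLaw s V (c i)) *
        (|codebookAvg c (fun z y => g z y x) - μg|
        + codebookAvg c (fun z y => W z y x - g z y x) + μb) :=
        Finset.sum_le_sum fun c _ => mul_le_mul_of_nonneg_left (hpt c) (hpi.1 c)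
    _ = ∑ c : ι → Z × (κ → Y), (∏ i, clusterLaw s V (c i)) *
        |codebookAvg c (fun z y => g z y x) - μg| + μb + μb := by
        simp_rw [mul_add, Finset.sum_add_distrib, ← Finset.sum_mul]
        rw [hpi.2, one_mul, sum_mul_codebookAvg hs hV]
    _ ≤ √((A / Fintype.card κ + B) / Fintype.card ι) * p x + μb + μb := by
        gcongr
        refine (sum_mul_abs_codebookAvg_sub_le hs hV _).trans ?_
        rw [← Real.sqrt_sq (hp.1 x), ← Real.sqrt_mul (by positivity)]
        apply Real.sqrt_le_sqrt
        rw [div_mul_eq_mul_div]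
        gcongr
        rw [add_mul, div_mul_eq_mul_div]
        have hle : μg ≤ p x := by linarith
        gcongr
        · calc ∑ z, s z * ∑ y, V z y * g z y x ^ 2
              ≤ ∑ z, s z * ∑ y, V z y * (A * p x * g z y x) := by
                refine Finset.sum_le_sum fun z _ => mul_le_mul_of_nonneg_left ?_ (hs.1 z)
                refine Finset.sum_le_sum fun y _ => mul_le_mul_of_nonneg_left ?_ ((hV z).1 y)
                rw [sq]
                exact mul_le_mul_of_nonneg_right (hgA z y x) (hg0 z y x)
            _ = A * p x * μg := by
                simp_rw [hμg, Finset.mul_sum]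
                exact Finset.sum_congr rfl fun z _ => Finset.sum_congr rfl fun y _ => by ring
            _ ≤ A * p x * p x := by
                have := mul_nonneg hA (hp.1 x); gcongr
            _ = A * p x ^ 2 := by ring
        · calc ∑ z, s z * (∑ y, V z y * g z y x) ^ 2
              ≤ ∑ z, s z * (B * p x * ∑ y, V z y * g z y x) := by
                refine Finset.sum_le_sum fun z _ => mul_le_mul_of_nonneg_left ?_ (hs.1 z)
                rw [sq]
                exact mul_le_mul_of_nonneg_right (hgB z x)
                  (Finset.sum_nonneg fun y _ => mul_nonneg ((hV z).1 y) (hg0 z y x))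
            _ = B * p x * μg := by
                rw [hμg, Finset.mul_sum]
                exact Finset.sum_congr rfl fun z _ => by ring
            _ ≤ B * p x * p x := by
                have := mul_nonneg hB (hp.1 x); gcongr
            _ = B * p x ^ 2 := by ring
    _ = √((A / Fintype.card κ + B) / Fintype.card ι) * p x + 2 * μb := by ring

end SoftCovering

/-! ### Typicality and asymptotic covering -/

/-- Shannon entropy in nats. -/
def natEntropy {X : Type*} [Fintype X] (q : X → ℝ) : ℝ := ∑ x, Real.negMulLog (q x)

/-- Relative frequency of the letter `t` in a word. -/
def empFreq {Ω : Type*} [DecidableEq Ω] {n : ℕ} (ω : Fin n → Ω) (t : Ω) : ℝ :=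
  (n : ℝ)⁻¹ * ∑ i, if ω i = t then 1 else 0

lemma sum_prod_mul_abs_empFreq_sub_le {Ω : Type*} [Fintype Ω] [DecidableEq Ω] {q : Ω → ℝ}
    (hq : q ∈ stdSimplex ℝ Ω) {n : ℕ} (hn : 0 < n) :
    ∑ ω : Fin n → Ω, (∏ i, q (ω i)) * ∑ t, |empFreq ω t - q t| ≤ Fintype.card Ω / √n := by
  have : Nonempty (Fin n) := ⟨⟨0, hn⟩⟩
  simp_rw [Finset.mul_sum]
  rw [Finset.sum_comm]
  have h : ∀ t, ∑ ω : Fin n → Ω, (∏ i, q (ω i)) * |empFreq ω t - q t| ≤ 1 / √n := fun t => by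
    refine (sum_mul_abs_le_sqrt (prod_mem_stdSimplex fun _ => hq) _).trans ?_
    have h1 := sum_prod_mul_mean_sub_sq_le (ι := Fin n) q hq.2 (fun a => if a = t then 1 else 0)
    simp only [Fintype.card_fin, mul_ite, mul_one, mul_zero, Finset.sum_ite_eq',
      Finset.mem_univ, if_true, ite_pow, one_pow, ne_eq, OfNat.ofNat_ne_zero, not_false_eq_true,
      zero_pow] at h1
    rw [one_div, ← Real.sqrt_inv, ← one_div]
    apply Real.sqrt_le_sqrt
    refine h1.trans ?_
    gcongr
    rw [← hq.2]
    exact Finset.single_le_sum (fun i _ => hq.1 i) (Finset.mem_univ t)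
  refine (Finset.sum_le_sum fun t _ => h t).trans ?_
  simp [div_eq_mul_inv]

/-- Chebyshev's inequality for i.i.d. sums, in the form of a bound by the square. -/
lemma sum_prod_mul_sq_div_le {Ω : Type*} [Fintype Ω] {q : Ω → ℝ}
    (hq : q ∈ stdSimplex ℝ Ω) {n : ℕ} (hn : 0 < n) (f : Ω → ℝ) {η : ℝ} (hη : 0 < η) :
    ∑ ω : Fin n → Ω, (∏ i, q (ω i)) * ((∑ i, (f (ω i) - ∑ a, q a * f a)) / (n * η)) ^ 2
      ≤ (∑ a, q a * f a ^ 2) / (n * η ^ 2) := by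
  have hn' : (0 : ℝ) < n := by exact_mod_cast hn
  set μ := ∑ a, q a * f a with hμ
  have h0 : ∑ a, q a * (f a - μ) = 0 := by
    simp_rw [mul_sub, Finset.sum_sub_distrib, ← Finset.sum_mul, hq.2]; linarith
  have h1 := sum_prod_mul_sq_of_centred (ι := Fin n) q hq.2 (fun a => f a - μ) h0
  have hv := sum_mul_sub_sq q hq.2 f
  rw [← hμ] at hv
  rw [hv, Fintype.card_fin] at h1
  simp_rw [div_pow, ← mul_div_assoc]
  rw [← Finset.sum_div, h1, div_le_div_iff₀ (by positivity) (by positivity)]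
  have : 0 ≤ (n : ℝ) * (n * η ^ 2) * μ ^ 2 := by positivity
  nlinarith

lemma sum_sum_sum_eq_sum_words {n : ℕ} {X Y Z : Type*} [Fintype X] [Fintype Y] [Fintype Z]
    (F : (Fin n → Z) → (Fin n → Y) → (Fin n → X) → ℝ) :
    ∑ z, ∑ y, ∑ x, F z y x = ∑ ω : Fin n → Z × Y × X,
      F (fun i => (ω i).1) (fun i => (ω i).2.1) (fun i => (ω i).2.2) := by
  simp_rw [← Fintype.sum_prod_type']
  let e : (Fin n → Z × Y × X) ≃ (Fin n → Z) × (Fin n → Y) × (Fin n → X) :=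
    (Equiv.arrowProdEquivProdArrow (Fin n) (fun _ => Z) (fun _ => Y × X)).trans
      (Equiv.prodCongr (Equiv.refl _) (Equiv.arrowProdEquivProdArrow (Fin n) (fun _ => Y)
        (fun _ => X)))
  exact (Equiv.sum_comp e fun a => F a.1 a.2.1 a.2.2).symm

section Covering

variable {X Y Z : Type*} [Fintype X] [Fintype Y] [Fintype Z]

/-- The mean information density is the mutual information. -/
lemma sum_mul_log_sub_log {V : Type*} [Fintype V] {r : V → ℝ} {W : V → X → ℝ} {p : X → ℝ}
    (hp : ∀ x, ∑ v, r v * W v x = p x) :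
    ∑ v, ∑ x, r v * W v x * (Real.log (W v x) - Real.log (p x))
      = natEntropy p - ∑ v, r v * natEntropy (W v) := by
  simp_rw [mul_sub, Finset.sum_sub_distrib]
  rw [Finset.sum_comm (f := fun v x => r v * W v x * Real.log (p x))]
  simp_rw [← Finset.sum_mul, hp, natEntropy, Real.negMulLog, Finset.mul_sum]
  simp only [neg_mul, Finset.sum_neg_distrib, mul_neg, mul_assoc]
  ring

/-- Superposition soft covering for `n` uses of a memoryless channel, with a codebook whose
codewords have, on average, nearly the joint type `s V W` with the channel output. Here
`I = I(X;YZ)` and `J = I(X;Z)` in nats, and `C` bounds the variances of the two information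
densities. -/
theorem exists_codebook_iid [DecidableEq X] [DecidableEq Y] [DecidableEq Z]
    {ι κ : Type*} [Fintype ι] [DecidableEq ι] [Nonempty ι] [Fintype κ] [DecidableEq κ]
    [Nonempty κ] {s : Z → ℝ} {V : Z → Y → ℝ} {W : Z → Y → X → ℝ} {p : X → ℝ}
    (hs : s ∈ stdSimplex ℝ Z) (hV : ∀ z, V z ∈ stdSimplex ℝ Y)
    (hW : ∀ z y, W z y ∈ stdSimplex ℝ X) (hp : p ∈ stdSimplex ℝ X)
    (hpW : ∀ x, p x = ∑ z, s z * ∑ y, V z y * W z y x) {I J η : ℝ}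
    (hI : I = natEntropy p - ∑ z, s z * ∑ y, V z y * natEntropy (W z y))
    (hJ : J = natEntropy p - ∑ z, s z * natEntropy fun x => ∑ y, V z y * W z y x)
    (hη : 0 < η) {C : ℝ}
    (hC : C = (∑ t : Z × Y × X, s t.1 * V t.1 t.2.1 * W t.1 t.2.1 t.2.2 *
        (Real.log (W t.1 t.2.1 t.2.2) - Real.log (p t.2.2)) ^ 2)
      + ∑ t : Z × Y × X, s t.1 * V t.1 t.2.1 * W t.1 t.2.1 t.2.2 *
        (Real.log (∑ y, V t.1 y * W t.1 y t.2.2) - Real.log (p t.2.2)) ^ 2)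
    {n : ℕ} (hn : 0 < n) :
    ∃ c : ι → (Fin n → Z) × (κ → Fin n → Y),
      ∑ x : Fin n → X, |codebookAvg c (fun z y => ∏ i, W (z i) (y i) (x i)) - ∏ i, p (x i)|
        + codebookAvg c (fun z y => ∑ x : Fin n → X, (∏ i, W (z i) (y i) (x i)) *
            ∑ t : Z × Y × X, |empFreq (fun i => (z i, y i, x i)) t
              - s t.1 * V t.1 t.2.1 * W t.1 t.2.1 t.2.2|)
        ≤ √((Real.exp (n * (I + η)) / Fintype.card κ + Real.exp (n * (J + η)))
            / Fintype.card ι)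
          + 2 * (C / (n * η ^ 2)) + Fintype.card (Z × Y × X) / √n := by
  classical
  set U : Z → X → ℝ := fun z x => ∑ y, V z y * W z y x with hU
  set q : Z × Y × X → ℝ := fun t => s t.1 * V t.1 t.2.1 * W t.1 t.2.1 t.2.2 with hq
  have hq1 : q ∈ stdSimplex ℝ (Z × Y × X) := by
    refine ⟨fun t => mul_nonneg (mul_nonneg (hs.1 _) ((hV _).1 _)) ((hW _ _).1 _), ?_⟩
    simp_rw [hq, Fintype.sum_prod_type, ← Finset.mul_sum, (hW _ _).2, mul_one, ← Finset.mul_sum,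
      (hV _).2, mul_one, hs.2]
  have hU0 : ∀ z x, 0 ≤ U z x := fun z x =>
    Finset.sum_nonneg fun y _ => mul_nonneg ((hV z).1 y) ((hW z y).1 x)
  set A := Real.exp (n * (I + η)) with hA
  set B := Real.exp (n * (J + η)) with hB
  set sn : (Fin n → Z) → ℝ := fun z => ∏ i, s (z i) with hsn
  set Vn : (Fin n → Z) → (Fin n → Y) → ℝ := fun z y => ∏ i, V (z i) (y i) with hVn
  set Wn : (Fin n → Z) → (Fin n → Y) → (Fin n → X) → ℝ :=
    fun z y x => ∏ i, W (z i) (y i) (x i) with hWn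
  set pn : (Fin n → X) → ℝ := fun x => ∏ i, p (x i) with hpn
  set Un : (Fin n → Z) → (Fin n → X) → ℝ := fun z x => ∏ i, U (z i) (x i) with hUn
  have hsn1 : sn ∈ stdSimplex ℝ _ := prod_mem_stdSimplex fun _ => hs
  have hVn1 : ∀ z, Vn z ∈ stdSimplex ℝ _ := fun z => prod_mem_stdSimplex fun i => hV (z i)
  have hWn0 : ∀ z y x, 0 ≤ Wn z y x := fun z y x => Finset.prod_nonneg fun i _ => (hW _ _).1 _
  have hpn1 : pn ∈ stdSimplex ℝ _ := prod_mem_stdSimplex fun _ => hp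
  have hUnV : ∀ z x, ∑ y, Vn z y * Wn z y x = Un z x := fun z x => by
    simp_rw [hVn, hWn, hUn, hU, ← Finset.prod_mul_distrib]
    exact sum_prod_eq_prod_sum fun i y => V (z i) y * W (z i) y (x i)
  have hpnW : ∀ x, pn x = ∑ z, sn z * ∑ y, Vn z y * Wn z y x := fun x => by
    simp_rw [hUnV, hsn, hUn, hpn, ← Finset.prod_mul_distrib, hpW]
    exact (sum_prod_eq_prod_sum fun i z => s z * U z (x i)).symm
  -- typicality asks for exactly the two likelihood ratio bounds that the one-shot bound needs
  set good : (Fin n → Z) → (Fin n → Y) → (Fin n → X) → Prop :=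
    fun z y x => Wn z y x ≤ A * pn x ∧ Un z x ≤ B * pn x with hgood
  set g : (Fin n → Z) → (Fin n → Y) → (Fin n → X) → ℝ :=
    fun z y x => if good z y x then Wn z y x else 0 with hg
  have hA0 : 0 ≤ A := (Real.exp_pos _).le
  have hB0 : 0 ≤ B := (Real.exp_pos _).le
  have hg0 : ∀ z y x, 0 ≤ g z y x := fun z y x => by
    simp only [hg]; split_ifs; exacts [hWn0 z y x, le_rfl]
  have hgW : ∀ z y x, g z y x ≤ Wn z y x := fun z y x => by
    simp only [hg]; split_ifs; exacts [le_rfl, hWn0 z y x]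
  have hgA : ∀ z y x, g z y x ≤ A * pn x := fun z y x => by
    simp only [hg]; split_ifs with h; exacts [h.1, mul_nonneg hA0 (hpn1.1 x)]
  have hgB : ∀ z x, ∑ y, Vn z y * g z y x ≤ B * pn x := fun z x => by
    by_cases h : Un z x ≤ B * pn x
    · refine le_trans ?_ h
      rw [← hUnV]
      exact Finset.sum_le_sum fun y _ => mul_le_mul_of_nonneg_left (hgW z y x) ((hVn1 z).1 y)
    · have : ∀ y, g z y x = 0 := fun y => by simp [hg, hgood, h]
      simp only [this, mul_zero, Finset.sum_const_zero]
      exact mul_nonneg hB0 (hpn1.1 x)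
  obtain ⟨c, hc⟩ := exists_codebook (ι := ι) (κ := κ) hsn1 hVn1 hpn1 hpnW hg0 hgW hA0 hB0 hgA hgB
    (fun z y => ∑ x : Fin n → X, Wn z y x * ∑ t : Z × Y × X,
      |empFreq (fun i => (z i, y i, x i)) t - q t|)
  refine ⟨c, hc.trans ?_⟩
  have hprod : ∀ ω : Fin n → Z × Y × X, sn (fun i => (ω i).1) *
      (Vn (fun i => (ω i).1) (fun i => (ω i).2.1) *
        Wn (fun i => (ω i).1) (fun i => (ω i).2.1) (fun i => (ω i).2.2)) = ∏ i, q (ω i) := by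
    intro ω
    simp_rw [hsn, hVn, hWn, hq, ← Finset.prod_mul_distrib, mul_assoc]
  gcongr
  · -- the atypical mass, by Chebyshev's inequality for the two information densities
    set f₁ : Z × Y × X → ℝ := fun t => Real.log (W t.1 t.2.1 t.2.2) - Real.log (p t.2.2) with hf₁
    set f₂ : Z × Y × X → ℝ := fun t => Real.log (U t.1 t.2.2) - Real.log (p t.2.2) with hf₂
    have hm₁ : ∑ t, q t * f₁ t = I := by
      have := sum_mul_log_sub_log (r := fun v : Z × Y => s v.1 * V v.1 v.2)
        (W := fun v => W v.1 v.2) (p := p) fun x => by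
          rw [hpW, Fintype.sum_prod_type]
          simp_rw [Finset.mul_sum, mul_assoc]
      rw [hI]
      simp_rw [Fintype.sum_prod_type] at this ⊢
      simp_rw [Finset.mul_sum] at this ⊢
      simp_rw [hq, hf₁]
      rw [this]
      simp_rw [mul_assoc]
    have hm₂ : ∑ t, q t * f₂ t = J := by
      have := sum_mul_log_sub_log (r := s) (W := U) (p := p) fun x => (hpW x).symm
      rw [hJ, ← this]
      simp_rw [Fintype.sum_prod_type, hq, hf₂]
      refine Finset.sum_congr rfl fun z _ => ?_
      rw [Finset.sum_comm]
      refine Finset.sum_congr rfl fun x _ => ?_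
      simp_rw [hU]
      rw [← Finset.sum_mul, Finset.mul_sum]
      congr 1
      exact Finset.sum_congr rfl fun y _ => by ring
    have hword : ∑ x, ∑ z, sn z * ∑ y, Vn z y * (Wn z y x - g z y x)
        = ∑ ω : Fin n → Z × Y × X, (∏ i, q (ω i)) *
          if good (fun i => (ω i).1) (fun i => (ω i).2.1) (fun i => (ω i).2.2) then 0 else 1 := by
      rw [Finset.sum_comm]
      simp_rw [Finset.mul_sum]
      simp_rw [Finset.sum_comm (s := (Finset.univ : Finset (Fin n → X)))]
      rw [sum_sum_sum_eq_sum_words fun z y x => sn z * (Vn z y * (Wn z y x - g z y x))]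
      refine Finset.sum_congr rfl fun ω _ => ?_
      rw [← hprod]
      simp only [hg]
      split_ifs <;> ring
    rw [hword, hC, add_div]
    have hc₁ := sum_prod_mul_sq_div_le hq1 hn f₁ hη
    have hc₂ := sum_prod_mul_sq_div_le hq1 hn f₂ hη
    rw [hm₁] at hc₁
    rw [hm₂] at hc₂
    refine le_trans ?_ (add_le_add hc₁ hc₂)
    rw [← Finset.sum_add_distrib]
    refine Finset.sum_le_sum fun ω _ => ?_
    rw [← mul_add]
    have hq0 : 0 ≤ ∏ i, q (ω i) := Finset.prod_nonneg fun i _ => hq1.1 _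
    rcases hq0.eq_or_lt with h0 | hpos
    · rw [← h0]; simp
    refine mul_le_mul_of_nonneg_left ?_ hpos.le
    split_ifs with hgd
    · positivity
    have hqi : ∀ i, 0 < q (ω i) := fun i => lt_of_le_of_ne (hq1.1 _) fun h =>
      hpos.ne' (Finset.prod_eq_zero (Finset.mem_univ i) h.symm)
    have hWi : ∀ i, 0 < W (ω i).1 (ω i).2.1 (ω i).2.2 := fun i =>
      lt_of_le_of_ne ((hW _ _).1 _) fun h => (hqi i).ne' (by simp [hq, ← h])
    have hVi : ∀ i, 0 < V (ω i).1 (ω i).2.1 := fun i =>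
      lt_of_le_of_ne ((hV _).1 _) fun h => (hqi i).ne' (by simp [hq, ← h])
    have hsi : ∀ i, 0 < s (ω i).1 := fun i =>
      lt_of_le_of_ne (hs.1 _) fun h => (hqi i).ne' (by simp [hq, ← h])
    have hUi : ∀ i, 0 < U (ω i).1 (ω i).2.2 := fun i =>
      (mul_pos (hVi i) (hWi i)).trans_le <| Finset.single_le_sum
        (f := fun y => V (ω i).1 y * W (ω i).1 y (ω i).2.2)
        (fun y _ => mul_nonneg ((hV _).1 y) ((hW _ _).1 _)) (Finset.mem_univ _)
    have hpi : ∀ i, 0 < p (ω i).2.2 := fun i => by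
      rw [hpW]
      exact (mul_pos (hsi i) (hUi i)).trans_le <| Finset.single_le_sum
        (f := fun z => s z * U z (ω i).2.2)
        (fun z _ => mul_nonneg (hs.1 z) (hU0 _ _)) (Finset.mem_univ _)
    have hn' : (0 : ℝ) < n := by exact_mod_cast hn
    -- an atypical word of positive probability has an information density `n η` above its mean
    have key : ∀ (a : Fin n → ℝ) (K : ℝ), (∀ i, 0 < a i) →
        ¬ (∏ i, a i ≤ Real.exp (n * (K + η)) * ∏ i, p (ω i).2.2) →
        1 ≤ ((∑ i, (Real.log (a i) - Real.log (p (ω i).2.2) - K)) / (n * η)) ^ 2 := by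
      intro a K ha hnot
      have h1 := Real.log_lt_log (mul_pos (Real.exp_pos _)
        (Finset.prod_pos fun i _ => hpi i)) (not_le.1 hnot)
      rw [Real.log_mul (Real.exp_pos _).ne' (Finset.prod_pos fun i _ => hpi i).ne', Real.log_exp,
        Real.log_prod fun i _ => (hpi i).ne', Real.log_prod fun i _ => (ha i).ne'] at h1
      have h2 : 1 ≤ (∑ i, (Real.log (a i) - Real.log (p (ω i).2.2) - K)) / (n * η) := by
        rw [one_le_div (by positivity)]
        simp only [Finset.sum_sub_distrib, Finset.sum_const, Finset.card_univ, Fintype.card_fin,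
          nsmul_eq_mul]
        linarith
      nlinarith
    simp only [hgood, not_and_or] at hgd
    rcases hgd with h | h
    · exact (key _ I hWi h).trans (le_add_of_nonneg_right (sq_nonneg _))
    · exact (key _ J hUi h).trans (le_add_of_nonneg_left (sq_nonneg _))
  · refine le_trans (le_of_eq ?_) (sum_prod_mul_abs_empFreq_sub_le hq1 hn)
    simp_rw [Finset.mul_sum (s := (Finset.univ : Finset (Fin n → Y))),
      Finset.mul_sum (s := (Finset.univ : Finset (Fin n → X)))]
    rw [sum_sum_sum_eq_sum_words fun z y x => sn z * (Vn z y * (Wn z y x *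
      ∑ t : Z × Y × X, |empFreq (fun i => (z i, y i, x i)) t - q t|))]
    refine Finset.sum_congr rfl fun ω _ => ?_
    rw [← hprod]
    ring

end Covering

/-! ### Codebooks at given rates, and posterior encoding -/

section Rates

variable {X Y Z : Type*} [Fintype X] [Fintype Y] [Fintype Z]

/-- Concavity of the entropy. -/
lemma sum_mul_natEntropy_le {V : Type*} [Fintype V] {r : V → ℝ} (hr : r ∈ stdSimplex ℝ V)
    {W : V → X → ℝ} (hW : ∀ v x, 0 ≤ W v x) :
    ∑ v, r v * natEntropy (W v) ≤ natEntropy fun x => ∑ v, r v * W v x := by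
  unfold natEntropy
  simp_rw [Finset.mul_sum]
  rw [Finset.sum_comm]
  refine Finset.sum_le_sum fun x _ => ?_
  simpa using Real.concaveOn_negMulLog.le_map_sum (t := Finset.univ) (w := r)
    (p := fun v => W v x) (fun v _ => hr.1 v) hr.2 (fun v _ => hW v x)

/-- Rounding a message set size down loses at most a factor two. -/
lemma half_le_floor {x : ℝ} (hx : 1 ≤ x) : x / 2 ≤ (⌊x⌋₊ : ℝ) := by
  have h1 : (1 : ℝ) ≤ (⌊x⌋₊ : ℝ) := by
    exact_mod_cast Nat.one_le_floor_iff x |>.2 hx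
  linarith [Nat.lt_floor_add_one x]

lemma tendsto_codebook_error (a b : ℝ) {δ : ℝ} (hδ : 0 < δ) :
    Filter.Tendsto (fun n : ℕ => √(6 * Real.exp (-(n * δ))) + a / n + b / √n)
      Filter.atTop (nhds 0) := by
  have h1 : Filter.Tendsto (fun n : ℕ => Real.exp (-(n * δ))) Filter.atTop (nhds 0) :=
    Real.tendsto_exp_neg_atTop_nhds_zero.comp
      (tendsto_natCast_atTop_atTop.atTop_mul_const hδ)
  have h2 := ((h1.const_mul 6).sqrt)
  have h3 : Filter.Tendsto (fun n : ℕ => a / (n : ℝ)) Filter.atTop (nhds 0) :=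
    tendsto_const_nhds.div_atTop tendsto_natCast_atTop_atTop
  have h4 : Filter.Tendsto (fun n : ℕ => b / √(n : ℝ)) Filter.atTop (nhds 0) :=
    tendsto_const_nhds.div_atTop (Real.tendsto_sqrt_atTop.comp tendsto_natCast_atTop_atTop)
  simpa using (h2.add h3).add h4

/-- Good codebooks exist at all rates above `J` (cloud centres) and `I` (all codewords). -/
theorem exists_codebook_of_rates [DecidableEq X] [DecidableEq Y] [DecidableEq Z]
    {s : Z → ℝ} {V : Z → Y → ℝ} {W : Z → Y → X → ℝ} {p : X → ℝ}
    (hs : s ∈ stdSimplex ℝ Z) (hV : ∀ z, V z ∈ stdSimplex ℝ Y)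
    (hW : ∀ z y, W z y ∈ stdSimplex ℝ X) (hp : p ∈ stdSimplex ℝ X)
    (hpW : ∀ x, p x = ∑ z, s z * ∑ y, V z y * W z y x) {I J : ℝ}
    (hI : I = natEntropy p - ∑ z, s z * ∑ y, V z y * natEntropy (W z y))
    (hJ : J = natEntropy p - ∑ z, s z * natEntropy fun x => ∑ y, V z y * W z y x)
    {ε δ : ℝ} (hε : 0 < ε) (hδ : 0 < δ) :
    ∃ N : ℕ, ∀ n ≥ N, 0 < n ∧ ∃ M K : ℕ, 0 < M ∧ 0 < K ∧ (M : ℝ) ≤ Real.exp (n * (J + δ)) ∧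
      (M * K : ℝ) ≤ Real.exp (n * (I + δ)) ∧
      ∃ c : Fin M → (Fin n → Z) × (Fin K → Fin n → Y),
      ∑ x : Fin n → X, |codebookAvg c (fun z y => ∏ i, W (z i) (y i) (x i)) - ∏ i, p (x i)|
        + codebookAvg c (fun z y => ∑ x : Fin n → X, (∏ i, W (z i) (y i) (x i)) *
            ∑ t : Z × Y × X, |empFreq (fun i => (z i, y i, x i)) t
              - s t.1 * V t.1 t.2.1 * W t.1 t.2.1 t.2.2|) ≤ ε := by
  have hJ0 : 0 ≤ J := by
    have h := sum_mul_natEntropy_le hs (W := fun z x => ∑ y, V z y * W z y x)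
      fun z x => Finset.sum_nonneg fun y _ => mul_nonneg ((hV z).1 y) ((hW z y).1 x)
    simp_rw [← hpW] at h
    linarith
  have hIJ : J ≤ I := by
    rw [hI, hJ]
    gcongr with z
    · exact hs.1 z
    · exact sum_mul_natEntropy_le (hV z) fun y x => (hW z y).1 x
  set C := (∑ t : Z × Y × X, s t.1 * V t.1 t.2.1 * W t.1 t.2.1 t.2.2 *
        (Real.log (W t.1 t.2.1 t.2.2) - Real.log (p t.2.2)) ^ 2)
      + ∑ t : Z × Y × X, s t.1 * V t.1 t.2.1 * W t.1 t.2.1 t.2.2 *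
        (Real.log (∑ y, V t.1 y * W t.1 y t.2.2) - Real.log (p t.2.2)) ^ 2 with hC
  -- with `M` of rate `J + δ / 2` and `K` of rate `I - J + δ / 2`, typicality of width `δ / 4`
  -- leaves an exponential margin `δ / 4` in both covering conditions
  have hη : 0 < δ / 4 := by positivity
  have hlim := (tendsto_codebook_error (2 * (C / (δ / 4) ^ 2)) (Fintype.card (Z × Y × X))
    hη).eventually_lt_const hε
  obtain ⟨N, hN⟩ := Filter.eventually_atTop.1 hlim
  refine ⟨N + 1, fun n hn => ?_⟩
  have hn0 : 0 < n := by omega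
  have hn' : (0 : ℝ) < n := by exact_mod_cast hn0
  refine ⟨hn0, ⌊Real.exp (n * (J + δ / 2))⌋₊, ⌊Real.exp (n * (I - J + δ / 2))⌋₊, ?_⟩
  have h1J : 1 ≤ Real.exp (n * (J + δ / 2)) := Real.one_le_exp (by positivity)
  have h1I : 1 ≤ Real.exp (n * (I - J + δ / 2)) :=
    Real.one_le_exp (mul_nonneg hn'.le (by linarith))
  have hMf := half_le_floor h1J
  have hKf := half_le_floor h1I
  have hM0 : 0 < ⌊Real.exp (n * (J + δ / 2))⌋₊ := Nat.floor_pos.2 h1J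
  have hK0 : 0 < ⌊Real.exp (n * (I - J + δ / 2))⌋₊ := Nat.floor_pos.2 h1I
  have hMle := Nat.floor_le (zero_le_one.trans h1J)
  have hKle := Nat.floor_le (zero_le_one.trans h1I)
  generalize ⌊Real.exp (n * (J + δ / 2))⌋₊ = M at *
  generalize ⌊Real.exp (n * (I - J + δ / 2))⌋₊ = K at *
  refine ⟨hM0, hK0, hMle.trans ?_, ?_, ?_⟩
  · gcongr; linarith
  · calc (M * K : ℝ) ≤ Real.exp (n * (J + δ / 2)) * Real.exp (n * (I - J + δ / 2)) := by gcongr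
      _ = Real.exp (n * (I + δ)) := by rw [← Real.exp_add]; ring_nf
  · have : Nonempty (Fin M) := ⟨⟨0, hM0⟩⟩
    have : Nonempty (Fin K) := ⟨⟨0, hK0⟩⟩
    obtain ⟨c, hc⟩ := exists_codebook_iid (ι := Fin M) (κ := Fin K) hs hV hW hp hpW hI hJ hη hC hn0
    refine ⟨c, hc.trans (le_trans ?_ (hN n (by omega)).le)⟩
    rw [Fintype.card_fin, Fintype.card_fin]
    have hMK : Real.exp (n * (I + δ / 4)) / K ≤ 2 * Real.exp (n * (J - δ / 4)) := by
      rw [div_le_iff₀ (by positivity)]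
      calc Real.exp (n * (I + δ / 4))
          = 2 * Real.exp (n * (J - δ / 4)) * (Real.exp (n * (I - J + δ / 2)) / 2) := by
            rw [mul_div_assoc', mul_comm (2 : ℝ), mul_assoc, mul_comm (2 : ℝ), ← mul_assoc,
              ← Real.exp_add, mul_div_cancel_right₀ _ two_ne_zero]
            ring_nf
        _ ≤ _ := by gcongr
    have hsq : (Real.exp (n * (I + δ / 4)) / K + Real.exp (n * (J + δ / 4))) / M
        ≤ 6 * Real.exp (-(n * (δ / 4))) := by
      rw [div_le_iff₀ (by positivity)]
      have e1 : Real.exp (n * (J - δ / 4)) ≤ Real.exp (n * (J + δ / 4)) := by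
        gcongr; linarith
      have e2 : Real.exp (n * (J + δ / 4))
          = Real.exp (-(n * (δ / 4))) * Real.exp (n * (J + δ / 2)) := by
        rw [← Real.exp_add]; ring_nf
      have e3 := mul_le_mul_of_nonneg_left hMf (Real.exp_pos (-(n * (δ / 4)))).le
      nlinarith
    have h3 : 2 * (C / (n * (δ / 4) ^ 2)) = 2 * (C / (δ / 4) ^ 2) / n := by
      field_simp
    rw [h3]
    gcongr

lemma sum_empFreq {Ω : Type*} [Fintype Ω] [DecidableEq Ω] {n : ℕ} (hn : 0 < n) (ω : Fin n → Ω) :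
    ∑ t, empFreq ω t = 1 := by
  unfold empFreq
  rw [← Finset.mul_sum, Finset.sum_comm]
  have : (n : ℝ) ≠ 0 := by positivity
  simp [this]

lemma sum_abs_empFreq_sub_le {Ω : Type*} [Fintype Ω] [DecidableEq Ω] {n : ℕ} (hn : 0 < n)
    (ω : Fin n → Ω) {q : Ω → ℝ} (hq : q ∈ stdSimplex ℝ Ω) :
    ∑ t, |empFreq ω t - q t| ≤ 2 := by
  have h : ∀ t, |empFreq ω t - q t| ≤ empFreq ω t + q t := fun t => by
    have h0 : 0 ≤ empFreq ω t := mul_nonneg (by positivity) (Finset.sum_nonneg fun i _ => by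
      split_ifs <;> norm_num)
    have := hq.1 t
    rw [abs_le]; constructor <;> linarith
  refine (Finset.sum_le_sum fun t _ => h t).trans ?_
  rw [Finset.sum_add_distrib, sum_empFreq hn, hq.2]
  norm_num

/-- Encoding by the posterior of the codeword given the source word: if the output of the reverse
channel `W` is nearly the source law, the resulting average joint type is nearly `s V W`. -/
theorem exists_encoder [DecidableEq X] [DecidableEq Y] [DecidableEq Z]
    {s : Z → ℝ} {V : Z → Y → ℝ} {W : Z → Y → X → ℝ} {p : X → ℝ}
    (hs : s ∈ stdSimplex ℝ Z) (hV : ∀ z, V z ∈ stdSimplex ℝ Y)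
    (hW : ∀ z y, W z y ∈ stdSimplex ℝ X) (hp : p ∈ stdSimplex ℝ X)
    {n M K : ℕ} (hn : 0 < n) (hM : 0 < M) (hK : 0 < K)
    (c : Fin M → (Fin n → Z) × (Fin K → Fin n → Y)) {ε : ℝ}
    (hc : ∑ x : Fin n → X,
        |codebookAvg c (fun z y => ∏ i, W (z i) (y i) (x i)) - ∏ i, p (x i)|
        + codebookAvg c (fun z y => ∑ x : Fin n → X, (∏ i, W (z i) (y i) (x i)) *
            ∑ t : Z × Y × X, |empFreq (fun i => (z i, y i, x i)) t
              - s t.1 * V t.1 t.2.1 * W t.1 t.2.1 t.2.2|) ≤ ε) :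
    ∃ L : (Fin n → X) → Fin M × Fin K → ℝ, (∀ x, L x ∈ stdSimplex ℝ (Fin M × Fin K)) ∧
      ∑ t : Z × Y × X, |(∑ x : Fin n → X, ∑ u : Fin M × Fin K, (∏ i, p (x i)) * L x u *
          empFreq (fun i => ((c u.1).1 i, (c u.1).2 u.2 i, x i)) t)
            - s t.1 * V t.1 t.2.1 * W t.1 t.2.1 t.2.2| ≤ 2 * ε := by
  set q : Z × Y × X → ℝ := fun t => s t.1 * V t.1 t.2.1 * W t.1 t.2.1 t.2.2 with hq
  have hq1 : q ∈ stdSimplex ℝ (Z × Y × X) := by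
    refine ⟨fun t => mul_nonneg (mul_nonneg (hs.1 _) ((hV _).1 _)) ((hW _ _).1 _), ?_⟩
    simp_rw [hq, Fintype.sum_prod_type, ← Finset.mul_sum, (hW _ _).2, mul_one, ← Finset.mul_sum,
      (hV _).2, mul_one, hs.2]
  have : Nonempty (Fin M × Fin K) := ⟨(⟨0, hM⟩, ⟨0, hK⟩)⟩
  -- joint law of a uniform codeword and the output of the reverse channel
  set Q : Fin M × Fin K → (Fin n → X) → ℝ := fun u x =>
    (M : ℝ)⁻¹ * ((K : ℝ)⁻¹ * ∏ i, W ((c u.1).1 i) ((c u.1).2 u.2 i) (x i)) with hQ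
  have hQ0 : ∀ u x, 0 ≤ Q u x := fun u x => by
    have := Finset.prod_nonneg fun i (_ : i ∈ Finset.univ) =>
      (hW ((c u.1).1 i) ((c u.1).2 u.2 i)).1 (x i)
    positivity
  have havg : ∀ f : (Fin n → Z) → (Fin n → Y) → ℝ, codebookAvg c f
      = ∑ u : Fin M × Fin K, (M : ℝ)⁻¹ * ((K : ℝ)⁻¹ * f (c u.1).1 ((c u.1).2 u.2)) := fun f => by
    unfold codebookAvg
    rw [Fintype.sum_prod_type]
    simp_rw [Finset.mul_sum, Fintype.card_fin]
  obtain ⟨L, hL, hQL⟩ := exists_kernel Q hQ0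
  refine ⟨L, hL, ?_⟩
  set h : Fin M × Fin K → (Fin n → X) → ℝ := fun u x =>
    ∑ t, |empFreq (fun i => ((c u.1).1 i, (c u.1).2 u.2 i, x i)) t - q t| with hh
  have hh0 : ∀ u x, 0 ≤ h u x := fun u x => Finset.sum_nonneg fun t _ => abs_nonneg _
  have hh2 : ∀ u x, h u x ≤ 2 := fun u x => sum_abs_empFreq_sub_le hn _ hq1
  have hpn := prod_mem_stdSimplex (ι := Fin n) fun _ => hp
  set pn : (Fin n → X) → ℝ := fun x => ∏ i, p (x i) with hpn'
  have hsum : ∀ t, (∑ x : Fin n → X, ∑ u : Fin M × Fin K, pn x * L x u *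
          empFreq (fun i => ((c u.1).1 i, (c u.1).2 u.2 i, x i)) t) - q t
      = ∑ x : Fin n → X, ∑ u : Fin M × Fin K, pn x * L x u *
          (empFreq (fun i => ((c u.1).1 i, (c u.1).2 u.2 i, x i)) t - q t) := fun t => by
    simp_rw [mul_sub, Finset.sum_sub_distrib, ← Finset.sum_mul, ← Finset.mul_sum, (hL _).2,
      mul_one, hpn.2, one_mul]
  calc ∑ t, |(∑ x : Fin n → X, ∑ u : Fin M × Fin K, pn x * L x u *
          empFreq (fun i => ((c u.1).1 i, (c u.1).2 u.2 i, x i)) t) - q t|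
      ≤ ∑ t, ∑ x : Fin n → X, ∑ u : Fin M × Fin K, pn x * L x u *
          |empFreq (fun i => ((c u.1).1 i, (c u.1).2 u.2 i, x i)) t - q t| := by
        refine Finset.sum_le_sum fun t _ => ?_
        rw [hsum]
        refine (Finset.abs_sum_le_sum_abs _ _).trans (Finset.sum_le_sum fun x _ => ?_)
        refine (Finset.abs_sum_le_sum_abs _ _).trans (Finset.sum_le_sum fun u _ => ?_)
        rw [abs_mul, abs_of_nonneg (mul_nonneg (hpn.1 x) ((hL x).1 u))]
    _ = ∑ x : Fin n → X, ∑ u : Fin M × Fin K, pn x * L x u * h u x := by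
        rw [Finset.sum_comm]
        refine Finset.sum_congr rfl fun x _ => ?_
        rw [Finset.sum_comm]
        simp_rw [hh, Finset.mul_sum]
    _ ≤ ∑ x : Fin n → X, ∑ u : Fin M × Fin K,
          (|(∑ u', Q u' x) - pn x| * L x u * 2 + Q u x * h u x) := by
        refine Finset.sum_le_sum fun x _ => Finset.sum_le_sum fun u _ => ?_
        rw [hQL u x]
        have h1 : pn x ≤ |(∑ u', Q u' x) - pn x| + ∑ u', Q u' x := by
          linarith [neg_abs_le ((∑ u', Q u' x) - pn x)]
        have h2 := mul_le_mul_of_nonneg_right h1 (mul_nonneg ((hL x).1 u) (hh0 u x))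
        have h3 := mul_le_mul_of_nonneg_left (hh2 u x)
          (mul_nonneg (abs_nonneg ((∑ u', Q u' x) - pn x)) ((hL x).1 u))
        nlinarith
    _ = 2 * (∑ x, |(∑ u', Q u' x) - pn x|) + ∑ u, ∑ x, Q u x * h u x := by
        simp_rw [Finset.sum_add_distrib]
        rw [Finset.sum_comm (f := fun x u => Q u x * h u x)]
        congr 1
        simp_rw [← Finset.sum_mul, ← Finset.mul_sum, (hL _).2, mul_one]
        rw [mul_comm]
    _ ≤ 2 * ε := by
        simp_rw [havg] at hc
        have h1 : ∑ u, ∑ x, Q u x * h u x = ∑ u : Fin M × Fin K, (M : ℝ)⁻¹ * ((K : ℝ)⁻¹ *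
            ∑ x : Fin n → X, (∏ i, W ((c u.1).1 i) ((c u.1).2 u.2 i) (x i)) * h u x) := by
          simp_rw [hQ, Finset.mul_sum, mul_assoc]
        have h2 : 0 ≤ ∑ u, ∑ x, Q u x * h u x := Finset.sum_nonneg fun u _ =>
          Finset.sum_nonneg fun x _ => mul_nonneg (hQ0 u x) (hh0 u x)
        rw [← h1] at hc
        linarith

end Rates

/-! ### Density matrices and the trace norm -/

section Matrices

variable {β : Type*} [Fintype β]

/-- Every density matrix is `Bᴴ B` with `B` of unit Frobenius norm. -/
lemma exists_eq_conjTranspose_mul_self {ρ : Matrix β β ℂ} (hρ : ρ.PosSemidef)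
    (ht : ρ.trace = 1) :
    ∃ B : Matrix β β ℂ, ρ = B.conjTranspose * B ∧ ∑ i, ∑ j, ‖B i j‖ ^ 2 = 1 := by
  classical
  obtain ⟨B, hB⟩ : ∃ B : Matrix β β ℂ, ρ = B.conjTranspose * B := by
    open scoped MatrixOrder in
    exact CStarAlgebra.nonneg_iff_eq_star_mul_self.mp hρ.nonneg
  refine ⟨B, hB, ?_⟩
  rw [hB, Matrix.trace] at ht
  simp only [Matrix.diag_apply, Matrix.mul_apply, Matrix.conjTranspose_apply] at ht
  rw [Finset.sum_comm]
  have h : ∀ i j, star (B i j) * B i j = ((‖B i j‖ ^ 2 : ℝ) : ℂ) := fun i j => by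
    rw [Complex.star_def, Complex.conj_mul']; push_cast; rfl
  simp_rw [h] at ht
  exact_mod_cast ht

lemma State.norm_apply_le_one (ρ : State β) (a b : β) : ‖ρ.1 a b‖ ≤ 1 := by
  obtain ⟨B, hB, h1⟩ := exists_eq_conjTranspose_mul_self ρ.2.1 ρ.2.2
  rw [hB, Matrix.mul_apply]
  calc ‖∑ k, B.conjTranspose a k * B k b‖ ≤ ∑ k, ‖B.conjTranspose a k * B k b‖ := norm_sum_le _ _
    _ ≤ ∑ k, ∑ j, ‖B k j‖ ^ 2 := by
        refine Finset.sum_le_sum fun k _ => ?_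
        rw [norm_mul, Matrix.conjTranspose_apply, norm_star]
        have ha := Finset.single_le_sum (f := fun j => ‖B k j‖ ^ 2)
          (fun j _ => sq_nonneg _) (Finset.mem_univ a)
        have hb := Finset.single_le_sum (f := fun j => ‖B k j‖ ^ 2)
          (fun j _ => sq_nonneg _) (Finset.mem_univ b)
        nlinarith [sq_nonneg (‖B k a‖ - ‖B k b‖)]
    _ = 1 := h1

variable (β) in
/-- The density matrices, as a set of matrices. -/
def stateSet : Set (Matrix β β ℂ) := {ρ | ρ.PosSemidef ∧ ρ.trace = 1}

variable (β) in
lemma isCompact_stateSet : IsCompact (stateSet β) := by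
  have hK : IsCompact {B : Matrix β β ℂ | ∑ i, ∑ j, ‖B i j‖ ^ 2 = 1} := by
    have hbox : IsCompact (Set.pi Set.univ fun _ : β => Set.pi Set.univ fun _ : β =>
        Metric.closedBall (0 : ℂ) 1) :=
      isCompact_univ_pi fun _ => isCompact_univ_pi fun _ => isCompact_closedBall _ _
    have hcl : IsClosed {B : Matrix β β ℂ | ∑ i, ∑ j, ‖B i j‖ ^ 2 = 1} :=
      isClosed_eq (by fun_prop) continuous_const
    refine IsCompact.of_isClosed_subset hbox hcl ?_
    intro B hB i _ j _
    have hB : ∑ i, ∑ j, ‖B i j‖ ^ 2 = 1 := hB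
    have h1 := Finset.single_le_sum (f := fun i => ∑ j, ‖B i j‖ ^ 2)
      (fun i _ => Finset.sum_nonneg fun j _ => sq_nonneg _) (Finset.mem_univ i)
    have h2 := Finset.single_le_sum (f := fun j => ‖B i j‖ ^ 2)
      (fun j _ => sq_nonneg _) (Finset.mem_univ j)
    rw [mem_closedBall_zero_iff]
    nlinarith [norm_nonneg (B i j)]
  have himg : stateSet β = (fun B : Matrix β β ℂ => B.conjTranspose * B) ''
      {B : Matrix β β ℂ | ∑ i, ∑ j, ‖B i j‖ ^ 2 = 1} := by
    ext ρ
    constructor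
    · rintro ⟨h1, h2⟩
      obtain ⟨B, hB, hB1⟩ := exists_eq_conjTranspose_mul_self h1 h2
      exact ⟨B, hB1, hB.symm⟩
    · rintro ⟨B, hB, rfl⟩
      refine ⟨Matrix.posSemidef_conjTranspose_mul_self B, ?_⟩
      have hB : ∑ i, ∑ j, ‖B i j‖ ^ 2 = 1 := hB
      rw [Matrix.trace]
      simp only [Matrix.diag_apply, Matrix.mul_apply, Matrix.conjTranspose_apply]
      rw [Finset.sum_comm] at hB
      have h : ∀ i j, star (B i j) * B i j = ((‖B i j‖ ^ 2 : ℝ) : ℂ) := fun i j => by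
        rw [Complex.star_def, Complex.conj_mul']; push_cast; rfl
      simp_rw [h]
      exact_mod_cast hB
  rw [himg]
  exact hK.image (by fun_prop)

variable [DecidableEq β]

lemma sum_eigenvalues_conjTranspose_mul_self (M : Matrix β β ℂ) :
    ∑ i, (Matrix.isHermitian_conjTranspose_mul_self M).eigenvalues i = ∑ i, ∑ j, ‖M i j‖ ^ 2 := by
  have h := (Matrix.isHermitian_conjTranspose_mul_self M).trace_eq_sum_eigenvalues
  rw [Matrix.trace] at h
  simp only [Matrix.diag_apply, Matrix.mul_apply, Matrix.conjTranspose_apply] at h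
  have h' : ∀ i j, star (M i j) * M i j = ((‖M i j‖ ^ 2 : ℝ) : ℂ) := fun i j => by
    rw [Complex.star_def, Complex.conj_mul']; push_cast; rfl
  simp_rw [h'] at h
  rw [Finset.sum_comm] at h
  symm
  exact Complex.ofReal_injective (by push_cast at h ⊢; exact h)

lemma norm_apply_le_traceNorm (M : Matrix β β ℂ) (a b : β) : ‖M a b‖ ≤ traceNorm M := by
  have h0 := fun i => Matrix.eigenvalues_conjTranspose_mul_self_nonneg M i
  have ht : 0 ≤ traceNorm M := Finset.sum_nonneg fun i _ => Real.sqrt_nonneg _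
  refine abs_le_of_sq_le_sq' ?_ ht |>.2
  have h1 := Finset.single_le_sum (f := fun i => ∑ j, ‖M i j‖ ^ 2)
      (fun i _ => Finset.sum_nonneg fun j _ => sq_nonneg _) (Finset.mem_univ a)
  have h2 := Finset.single_le_sum (f := fun j => ‖M a j‖ ^ 2)
      (fun j _ => sq_nonneg _) (Finset.mem_univ b)
  refine (h2.trans h1).trans ?_
  rw [← sum_eigenvalues_conjTranspose_mul_self]
  have h3 := Finset.sum_sq_le_sq_sum_of_nonneg (s := Finset.univ)
    (f := fun i => √((Matrix.isHermitian_conjTranspose_mul_self M).eigenvalues i))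
    fun i _ => Real.sqrt_nonneg _
  simp_rw [Real.sq_sqrt (h0 _)] at h3
  exact h3

/-- The trace norm is small when all entries are. -/
lemma traceNorm_le_of_forall_norm_le (M : Matrix β β ℂ) {ε : ℝ} (hε : 0 ≤ ε)
    (h : ∀ a b, ‖M a b‖ ≤ ε) : traceNorm M ≤ (Fintype.card β : ℝ) ^ 2 * ε := by
  have h0 := fun i => Matrix.eigenvalues_conjTranspose_mul_self_nonneg M i
  have hi : ∀ i, √((Matrix.isHermitian_conjTranspose_mul_self M).eigenvalues i)
      ≤ Fintype.card β * ε := fun i => by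
    rw [Real.sqrt_le_left (by positivity)]
    refine (Finset.single_le_sum (f := fun i =>
      (Matrix.isHermitian_conjTranspose_mul_self M).eigenvalues i) (fun i _ => h0 i)
      (Finset.mem_univ i)).trans ?_
    rw [sum_eigenvalues_conjTranspose_mul_self]
    calc ∑ i, ∑ j, ‖M i j‖ ^ 2 ≤ ∑ i : β, ∑ j : β, ε ^ 2 :=
          Finset.sum_le_sum fun i _ => Finset.sum_le_sum fun j _ =>
            pow_le_pow_left₀ (norm_nonneg _) (h i j) 2
      _ = (Fintype.card β * ε) ^ 2 := by simp; ring
  refine (Finset.sum_le_sum fun i _ => hi i).trans (le_of_eq ?_)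
  simp
  ring

/-! ### Partial traces -/

lemma reduced_mem_stateSet {n : ℕ} (ρ : State (Fin n → β)) (i : Fin n) :
    reduced ρ.1 i ∈ stateSet β := by
  refine ⟨?_, ?_⟩
  · have h : reduced ρ.1 i = ∑ g : {j // j ≠ i} → β, ρ.1.submatrix
        (fun b => (Equiv.funSplitAt i β).symm (b, g))
        (fun b => (Equiv.funSplitAt i β).symm (b, g)) := by
      ext b b'
      simp only [reduced, Matrix.of_apply, Matrix.sum_apply, Matrix.submatrix_apply]
      rw [← Equiv.sum_comp (Equiv.funSplitAt i β).symm, Fintype.sum_prod_type,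
        Finset.sum_eq_single b]
      · refine Finset.sum_congr rfl fun g _ => ?_
        rw [if_pos (by simp [Equiv.funSplitAt, Equiv.piSplitAt])]
        refine congrArg _ (funext fun j => ?_)
        by_cases hj : j = i
        · subst hj; simp [Equiv.funSplitAt, Equiv.piSplitAt]
        · simp [Equiv.funSplitAt, Equiv.piSplitAt, hj]
      · intro a _ ha
        refine Finset.sum_eq_zero fun g _ => ?_
        rw [if_neg (by simpa [Equiv.funSplitAt, Equiv.piSplitAt] using ha)]
      · simp
    rw [h]
    exact Matrix.posSemidef_sum _ fun g _ => ρ.2.1.submatrix _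
  · refine Eq.trans ?_ ρ.2.2
    simp only [Matrix.trace, reduced, Matrix.diag_apply, Matrix.of_apply]
    rw [Finset.sum_comm]
    refine Finset.sum_congr rfl fun f _ => ?_
    simp

lemma reduced_tensorProd {n : ℕ} (ρ : Fin n → Matrix β β ℂ) (hρ : ∀ j, (ρ j).trace = 1)
    (i : Fin n) : reduced (tensorProd ρ) i = ρ i := by
  ext b b'
  simp only [reduced, tensorProd, Matrix.of_apply]
  have h : ∀ f : Fin n → β, (if f i = b then ∏ j, ρ j (f j) (Function.update f i b' j) else 0)
      = ∏ j, if j = i then (if f j = b then ρ j b b' else 0) else ρ j (f j) (f j) := by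
    intro f
    rw [← Finset.mul_prod_erase _ _ (Finset.mem_univ i),
      ← Finset.mul_prod_erase _ _ (Finset.mem_univ i), if_pos rfl]
    have he : ∏ j ∈ Finset.univ.erase i, ρ j (f j) (Function.update f i b' j)
        = ∏ j ∈ Finset.univ.erase i,
          if j = i then (if f j = b then ρ j b b' else 0) else ρ j (f j) (f j) := by
      refine Finset.prod_congr rfl fun j hj => ?_
      have hj := Finset.ne_of_mem_erase hj
      simp [hj]
    rw [he]
    split_ifs with hb
    · simp [hb]
    · simp
  simp_rw [h]
  rw [sum_prod_eq_prod_sum fun j a =>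
    if j = i then (if a = b then ρ j b b' else 0) else ρ j a a]
  rw [← Finset.mul_prod_erase _ _ (Finset.mem_univ i), Finset.prod_eq_one]
  · simp
  · intro j hj
    have hj := Finset.ne_of_mem_erase hj
    simp only [hj, if_false]
    exact hρ j

/-- The product of density matrices is a density matrix. -/
lemma tensorProd_mem_stateSet {β : Type*} [Fintype β] {n : ℕ} (ρ : Fin n → State β) :
    tensorProd (fun j => (ρ j).1) ∈ stateSet (Fin n → β) := by
  refine ⟨?_, ?_⟩
  · choose B hB _ using fun j => exists_eq_conjTranspose_mul_self (ρ j).2.1 (ρ j).2.2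
    have h : tensorProd (fun j => (ρ j).1)
        = (tensorProd B).conjTranspose * tensorProd B := by
      ext f g
      simp only [tensorProd, Matrix.of_apply, Matrix.mul_apply, Matrix.conjTranspose_apply,
        star_prod, ← Finset.prod_mul_distrib]
      rw [sum_prod_eq_prod_sum fun j a => star (B j a (f j)) * B j a (g j)]
      refine Finset.prod_congr rfl fun j _ => ?_
      rw [hB j]
      simp [Matrix.mul_apply]
    rw [h]
    exact Matrix.posSemidef_conjTranspose_mul_self _
  · simp only [Matrix.trace, tensorProd, Matrix.diag_apply, Matrix.of_apply]
    rw [sum_prod_eq_prod_sum fun j a => (ρ j).1 a a]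
    refine Finset.prod_eq_one fun j _ => (ρ j).2.2

end Matrices

/-! ### Entries of the cascade states, and mutual information -/

section Entries

variable {𝒳 α β γ : Type*} [Fintype 𝒳] [DecidableEq 𝒳] [Fintype α] [DecidableEq α]
  [Fintype β] [DecidableEq β] [Fintype γ] [DecidableEq γ]

lemma ketbra_apply {X : Type*} [DecidableEq X] (x u v : X) :
    ketbra x u v = if u = v then (if x = u then 1 else 0) else 0 := by
  unfold ketbra
  rw [Matrix.single_apply]
  by_cases h : u = v
  · subst h; simp
  · rw [if_neg h, if_neg]
    rintro ⟨rfl, h'⟩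
    exact h h'

lemma extendedState_apply {𝒳 α β γ : Type*} [Fintype 𝒳] [DecidableEq 𝒳] [Fintype α]
    [Fintype β] [Fintype γ] (p : stdSimplex ℝ 𝒳) (ω : 𝒳 → State (α × β × γ)) (x x' : 𝒳)
    (i j : α × β × γ) :
    extendedState p ω (x, i) (x', j) = if x = x' then (p.1 x : ℂ) * (ω x).1 i j else 0 := by
  unfold extendedState
  simp only [Matrix.sum_apply, Matrix.smul_apply, Matrix.kroneckerMap_apply, ketbra_apply,
    smul_eq_mul]
  split_ifs with h
  · simp
  · simp

lemma traceYZ_cqState_apply {𝒳 α β γ : Type*} [Fintype 𝒳] [DecidableEq 𝒳] [Fintype α]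
    [Fintype β] [Fintype γ] (σ : ProductExtension 𝒳 α β γ) (x x' : 𝒳) (a a' : α) (b b' : β)
    (c c' : γ) :
    traceYZ σ.cqState (x, a, b, c) (x', a', b', c') = if x = x' then
      (σ.stateA x).1 a a' * ∑ y, ∑ z, (σ.pXYZ.1 (x, y, z) : ℂ) *
        ((σ.stateB y).1 b b' * (σ.stateC z).1 c c') else 0 := by
  unfold traceYZ ProductExtension.cqState
  simp only [Matrix.of_apply, Matrix.sum_apply, Matrix.smul_apply, Matrix.kroneckerMap_apply,
    ketbra_apply, smul_eq_mul]
  split_ifs with h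
  · simp only [if_true, ite_mul, one_mul, zero_mul, mul_ite, mul_zero,
      Finset.sum_ite_eq', Finset.mem_univ]
    rw [Finset.mul_sum]
    refine Finset.sum_congr rfl fun y _ => ?_
    rw [Finset.mul_sum]
    refine Finset.sum_congr rfl fun z _ => ?_
    ring
  · simp

/-- Entries of the average state of a code: given the source letter, Alice's system is in a product
state with the others. -/
lemma averageState_apply {M₁ M₂ n : ℕ} (co : CascadeCode 𝒳 α β γ M₁ M₂ n)
    (p : stdSimplex ℝ 𝒳) (x x' : 𝒳) (a a' : α) (b b' : β) (c c' : γ) :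
    co.averageState p (x, a, b, c) (x', a', b', c') = if x = x' then
      (co.encA x).1 a a' * ∑ w : Fin n → 𝒳, ∑ m₁, ∑ m₂,
        (((∏ j, p.1 (w j)) * (co.alice w).1 m₁ * (co.bob m₁).1 m₂ : ℝ) : ℂ) *
          ((n : ℂ)⁻¹ * ∑ i, if w i = x then
            reduced (co.encB m₁).1 i b b' * reduced (co.encC m₂).1 i c c' else 0) else 0 := by
  unfold CascadeCode.averageState
  have hA : ∀ (w : Fin n → 𝒳) (i : Fin n),
      reduced (tensorProd fun j => (co.encA (w j)).1) i = (co.encA (w i)).1 := fun w i =>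
    reduced_tensorProd _ (fun j => (co.encA (w j)).2.2) i
  simp only [Matrix.sum_apply, Matrix.smul_apply, Matrix.kroneckerMap_apply, hA,
    ketbra_apply, smul_eq_mul]
  split_ifs with h
  · simp_rw [Finset.mul_sum]
    refine Finset.sum_congr rfl fun w _ => Finset.sum_congr rfl fun m₁ _ =>
      Finset.sum_congr rfl fun m₂ _ => Finset.sum_congr rfl fun i _ => ?_
    split_ifs with hw
    · rw [hw]; ring
    · simp
  · simp

lemma entropy_mul_log_two {U : Type*} [Fintype U] (q : U → ℝ) :
    entropy q * Real.log 2 = natEntropy q := by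
  have h2 : Real.log 2 ≠ 0 := (Real.log_pos one_lt_two).ne'
  unfold entropy natEntropy
  field_simp

/-- Mutual information as an entropy minus a conditional entropy, in nats. -/
lemma mutualInfo_mul_log_two {U V : Type*} [Fintype U] [Fintype V] {q : U × V → ℝ} {r : V → ℝ}
    {W : V → U → ℝ} (hW : ∀ v, ∑ u, W v u = 1) (hq : ∀ u v, q (u, v) = r v * W v u) :
    mutualInfo q * Real.log 2
      = natEntropy (fun u => ∑ v, q (u, v)) - ∑ v, r v * natEntropy (W v) := by
  unfold mutualInfo
  simp only [sub_mul, add_mul, entropy_mul_log_two]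
  have hV : ∀ v, ∑ u, q (u, v) = r v := fun v => by
    simp_rw [hq, ← Finset.mul_sum, hW, mul_one]
  have hjoint : natEntropy q = natEntropy r + ∑ v, r v * natEntropy (W v) := by
    unfold natEntropy
    rw [Fintype.sum_prod_type, Finset.sum_comm, ← Finset.sum_add_distrib]
    refine Finset.sum_congr rfl fun v _ => ?_
    simp_rw [hq, Real.negMulLog_mul, Finset.sum_add_distrib, ← Finset.sum_mul, hW, one_mul,
      ← Finset.mul_sum]
  simp_rw [hV]
  rw [hjoint]
  ring

lemma sum_empFreq_mul {Ω : Type*} [Fintype Ω] [DecidableEq Ω] {n : ℕ} (ω : Fin n → Ω)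
    (F : Ω → ℂ) : ∑ t, (empFreq ω t : ℂ) * F t = (n : ℂ)⁻¹ * ∑ i, F (ω i) := by
  unfold empFreq
  push_cast
  simp_rw [mul_assoc, ← Finset.mul_sum, Finset.sum_mul]
  rw [Finset.sum_comm]
  refine congrArg _ (Finset.sum_congr rfl fun i _ => ?_)
  rw [Finset.sum_eq_single (ω i)]
  · simp
  · intro t _ ht
    simp [Ne.symm ht]
  · simp

/-- The `X`-marginal of a product extension is the source law. -/
lemma sum_pXYZ_eq {𝒳 α β γ : Type*} [Fintype 𝒳] [DecidableEq 𝒳] [Fintype α]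
    [Fintype β] [Fintype γ] {p : stdSimplex ℝ 𝒳} {ω : 𝒳 → State (α × β × γ)}
    {σ : ProductExtension 𝒳 α β γ} (hσ : σ ∈ cascadeExtensions p ω) (x : 𝒳) :
    ∑ v : Fin σ.cardY × Fin σ.cardZ, σ.pXYZ.1 (x, v) = p.1 x := by
  have hσ : traceYZ σ.cqState = extendedState p ω := hσ
  have h : ∀ (i : α × β × γ), traceYZ σ.cqState (x, i) (x, i) = extendedState p ω (x, i) (x, i) :=
    fun i => by rw [hσ]
  have h1 := Finset.sum_congr (rfl : (Finset.univ : Finset (α × β × γ)) = _) fun i _ => h i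
  have hω : ∑ i, (ω x).1 i i = 1 := (ω x).2.2
  have hA : ∑ a, (σ.stateA x).1 a a = 1 := (σ.stateA x).2.2
  have hB : ∀ y, ∑ b, (σ.stateB y).1 b b = 1 := fun y => (σ.stateB y).2.2
  have hC : ∀ z, ∑ c, (σ.stateC z).1 c c = 1 := fun z => (σ.stateC z).2.2
  have hBC : ∑ b, ∑ c, ∑ y, ∑ z, (σ.pXYZ.1 (x, y, z) : ℂ) *
        ((σ.stateB y).1 b b * (σ.stateC z).1 c c) = ∑ y, ∑ z, (σ.pXYZ.1 (x, y, z) : ℂ) := by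
    rw [Finset.sum_congr rfl fun b _ => Finset.sum_comm, Finset.sum_comm]
    refine Finset.sum_congr rfl fun y _ => ?_
    rw [Finset.sum_congr rfl fun b _ => Finset.sum_comm, Finset.sum_comm]
    refine Finset.sum_congr rfl fun z _ => ?_
    simp_rw [← Finset.mul_sum, hC, mul_one, hB, mul_one]
  simp only [extendedState_apply, if_true, ← Finset.mul_sum, hω, mul_one] at h1
  simp only [Fintype.sum_prod_type, traceYZ_cqState_apply, if_true, ← Finset.mul_sum, hBC,
    ← Finset.sum_mul, hA, one_mul] at h1
  rw [Fintype.sum_prod_type]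
  exact_mod_cast h1

end Entries

/-! ### Achievability -/

section Achievability

variable {𝒳 α β γ : Type*} [Fintype 𝒳] [DecidableEq 𝒳] [Fintype α] [DecidableEq α]
  [Fintype β] [DecidableEq β] [Fintype γ] [DecidableEq γ]

lemma sum_sum_relabel {U M₁ M₂ : Type*} [Fintype U] [Fintype M₁] [Fintype M₂] [DecidableEq M₁]
    [DecidableEq M₂] (P : ℝ) (L : U → ℝ) (e : U → M₁) (f : M₁ → M₂) (G : M₁ → M₂ → ℂ) :
    ∑ m₁, ∑ m₂, ((P * (∑ u, L u * if e u = m₁ then 1 else 0) *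
        (Pi.single (f m₁) 1 : M₂ → ℝ) m₂ : ℝ) : ℂ) * G m₁ m₂
      = ∑ u, ((P * L u : ℝ) : ℂ) * G (e u) (f (e u)) := by
  have h : ∀ m₁, ∑ m₂, ((P * (∑ u, L u * if e u = m₁ then 1 else 0) *
        (Pi.single (f m₁) 1 : M₂ → ℝ) m₂ : ℝ) : ℂ) * G m₁ m₂
      = ∑ u, if e u = m₁ then ((P * L u : ℝ) : ℂ) * G m₁ (f m₁) else 0 := fun m₁ => by
    rw [Finset.sum_eq_single (f m₁)]
    · push_cast
      simp only [Pi.single_eq_same, Complex.ofReal_one, mul_one, Finset.mul_sum, Finset.sum_mul]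
      refine Finset.sum_congr rfl fun u _ => ?_
      split_ifs <;> simp
    · intro m₂ _ hm
      simp [Pi.single_eq_of_ne hm]
    · simp
  simp_rw [h]
  rw [Finset.sum_comm]
  simp

/-- A superposition codebook with an encoder is a cascade code: Bob receives the full index of the
codeword and forwards the index of its cloud centre. -/
theorem exists_code_of_encoder (p : stdSimplex ℝ 𝒳) {Y Z : Type*} [Fintype Y] [Fintype Z]
    [DecidableEq Y] [DecidableEq Z] (A : 𝒳 → State α) (B : Y → State β) (C : Z → State γ)
    {n M K M₁ M₂ : ℕ} (hM : 0 < M) (hK : 0 < K) (h₁ : M * K ≤ M₁) (h₂ : M ≤ M₂)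
    (cb : Fin M → (Fin n → Z) × (Fin K → Fin n → Y))
    (L : (Fin n → 𝒳) → Fin M × Fin K → ℝ) (hL : ∀ x, L x ∈ stdSimplex ℝ (Fin M × Fin K)) :
    ∃ co : CascadeCode 𝒳 α β γ M₁ M₂ n, ∀ x x' a a' b b' c c',
      co.averageState p (x, a, b, c) (x', a', b', c') = if x = x' then
        (A x).1 a a' * ∑ t : Z × Y × 𝒳,
          ((∑ w : Fin n → 𝒳, ∑ u : Fin M × Fin K, (∏ i, p.1 (w i)) * L w u *
            empFreq (fun i => ((cb u.1).1 i, (cb u.1).2 u.2 i, w i)) t : ℝ) : ℂ) *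
          (if t.2.2 = x then (B t.2.1).1 b b' * (C t.1).1 c c' else 0) else 0 := by
  have : Nonempty (Fin M × Fin K) := ⟨(⟨0, hM⟩, ⟨0, hK⟩)⟩
  have : Nonempty (Fin M) := ⟨⟨0, hM⟩⟩
  let e : Fin M × Fin K → Fin M₁ := fun u => Fin.castLE h₁ (finProdFinEquiv u)
  have he : Function.Injective e :=
    (Fin.castLE_injective h₁).comp finProdFinEquiv.injective
  obtain ⟨d, hd⟩ := he.hasLeftInverse
  obtain ⟨d₂, hd₂⟩ := (Fin.castLE_injective h₂).hasLeftInverse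
  let co : CascadeCode 𝒳 α β γ M₁ M₂ n :=
    { alice := fun x => ⟨fun m => ∑ u, L x u * if e u = m then 1 else 0,
        fun m => Finset.sum_nonneg fun u _ => mul_nonneg ((hL x).1 u) (by split_ifs <;> norm_num),
        by rw [Finset.sum_comm]; simpa using (hL x).2⟩
      bob := fun m => ⟨Pi.single (Fin.castLE h₂ (d m).1) 1, single_mem_stdSimplex ℝ _⟩
      encA := A
      encB := fun m => ⟨tensorProd fun i => (B ((cb (d m).1).2 (d m).2 i)).1,
        tensorProd_mem_stateSet _⟩
      encC := fun m => ⟨tensorProd fun i => (C ((cb (d₂ m)).1 i)).1,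
        tensorProd_mem_stateSet _⟩ }
  refine ⟨co, fun x x' a a' b b' c c' => ?_⟩
  rw [averageState_apply]
  refine if_congr Iff.rfl ?_ rfl
  congr 1
  have hB : ∀ m i, reduced (co.encB m).1 i = (B ((cb (d m).1).2 (d m).2 i)).1 := fun m i =>
    reduced_tensorProd _ (fun j => (B _).2.2) i
  have hC : ∀ m i, reduced (co.encC m).1 i = (C ((cb (d₂ m)).1 i)).1 := fun m i =>
    reduced_tensorProd _ (fun j => (C _).2.2) i
  simp only [hB, hC]
  calc ∑ w : Fin n → 𝒳, ∑ m₁, ∑ m₂,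
        (((∏ j, p.1 (w j)) * (co.alice w).1 m₁ * (co.bob m₁).1 m₂ : ℝ) : ℂ) *
          ((n : ℂ)⁻¹ * ∑ i, if w i = x then
            (B ((cb (d m₁).1).2 (d m₁).2 i)).1 b b' * (C ((cb (d₂ m₂)).1 i)).1 c c' else 0)
      = ∑ w : Fin n → 𝒳, ∑ u : Fin M × Fin K, (((∏ j, p.1 (w j)) * L w u : ℝ) : ℂ) *
          ((n : ℂ)⁻¹ * ∑ i, if w i = x then
            (B ((cb u.1).2 u.2 i)).1 b b' * (C ((cb u.1).1 i)).1 c c' else 0) := by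
        refine Finset.sum_congr rfl fun w _ => ?_
        refine (sum_sum_relabel (∏ j, p.1 (w j)) (L w) e (fun m => Fin.castLE h₂ (d m).1)
          fun m₁ m₂ => ((n : ℂ)⁻¹ * ∑ i, if w i = x then
            (B ((cb (d m₁).1).2 (d m₁).2 i)).1 b b' * (C ((cb (d₂ m₂)).1 i)).1 c c'
              else 0)).trans ?_
        simp_rw [hd _, hd₂ _]
    _ = ∑ w : Fin n → 𝒳, ∑ u : Fin M × Fin K, (((∏ j, p.1 (w j)) * L w u : ℝ) : ℂ) *
          ∑ t : Z × Y × 𝒳, (empFreq (fun i => ((cb u.1).1 i, (cb u.1).2 u.2 i, w i)) t : ℂ) *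
          (if t.2.2 = x then (B t.2.1).1 b b' * (C t.1).1 c c' else 0) := by
        simp_rw [sum_empFreq_mul]
    _ = _ := by
        push_cast
        simp_rw [Finset.mul_sum, Finset.sum_mul]
        symm
        rw [Finset.sum_comm]
        refine Finset.sum_congr rfl fun w _ => ?_
        rw [Finset.sum_comm]
        exact Finset.sum_congr rfl fun u _ => Finset.sum_congr rfl fun t _ => by ring

/-- Factorization of the law of a product extension along `Z → Y → X`. -/
lemma exists_factorization {X Y Z : Type*} [Fintype X] [Fintype Y] [Fintype Z]
    {q : X × Y × Z → ℝ} (hq : q ∈ stdSimplex ℝ (X × Y × Z)) :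
    ∃ (s : Z → ℝ) (V : Z → Y → ℝ) (W : Z → Y → X → ℝ), s ∈ stdSimplex ℝ Z ∧
      (∀ z, V z ∈ stdSimplex ℝ Y) ∧ (∀ z y, W z y ∈ stdSimplex ℝ X) ∧
      ∀ x y z, q (x, y, z) = s z * V z y * W z y x := by
  have hne : Nonempty (X × Y × Z) := by
    by_contra h
    rw [not_nonempty_iff] at h
    simpa using hq.2
  obtain ⟨x₀, y₀, z₀⟩ := hne
  have : Nonempty X := ⟨x₀⟩
  have : Nonempty Y := ⟨y₀⟩
  obtain ⟨W, hW, hqW⟩ := exists_kernel (fun x (v : Z × Y) => q (x, v.2, v.1))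
    fun x v => hq.1 _
  obtain ⟨V, hV, hqV⟩ := exists_kernel (fun y (z : Z) => ∑ x, q (x, y, z))
    fun y z => Finset.sum_nonneg fun x _ => hq.1 _
  refine ⟨fun z => ∑ y, ∑ x, q (x, y, z), V, fun z y => W (z, y),
    ⟨fun z => Finset.sum_nonneg fun y _ => Finset.sum_nonneg fun x _ => hq.1 _, ?_⟩, hV,
    fun z y => hW _, fun x y z => ?_⟩
  · refine Eq.trans ?_ hq.2
    simp_rw [Fintype.sum_prod_type]
    rw [Finset.sum_comm, Finset.sum_congr rfl fun y _ => Finset.sum_comm, Finset.sum_comm]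
  · rw [← hqV]
    exact hqW x (z, y)

lemma infoXYZ_mul_log_two {𝒳 α β γ : Type*} [Fintype 𝒳] [Fintype α] [Fintype β] [Fintype γ]
    {σ : ProductExtension 𝒳 α β γ} {p : 𝒳 → ℝ} (hp : ∀ x, ∑ v, σ.pXYZ.1 (x, v) = p x)
    {s : Fin σ.cardZ → ℝ} {V : Fin σ.cardZ → Fin σ.cardY → ℝ}
    {W : Fin σ.cardZ → Fin σ.cardY → 𝒳 → ℝ} (hW : ∀ z y, ∑ x, W z y x = 1)
    (hq : ∀ x y z, σ.pXYZ.1 (x, y, z) = s z * V z y * W z y x) :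
    σ.infoXYZ * Real.log 2 = natEntropy p - ∑ z, s z * ∑ y, V z y * natEntropy (W z y) := by
  have h := mutualInfo_mul_log_two (q := σ.pXYZ.1)
    (r := fun v : Fin σ.cardY × Fin σ.cardZ => s v.2 * V v.2 v.1) (W := fun v => W v.2 v.1)
    (fun v => hW _ _) fun u v => hq u v.1 v.2
  unfold ProductExtension.infoXYZ
  rw [h]
  simp_rw [hp]
  rw [Fintype.sum_prod_type, Finset.sum_comm]
  simp_rw [Finset.mul_sum, mul_assoc]

lemma infoXZ_mul_log_two {𝒳 α β γ : Type*} [Fintype 𝒳] [Fintype α] [Fintype β] [Fintype γ]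
    {σ : ProductExtension 𝒳 α β γ} {p : 𝒳 → ℝ} (hp : ∀ x, ∑ v, σ.pXYZ.1 (x, v) = p x)
    {s : Fin σ.cardZ → ℝ} {V : Fin σ.cardZ → Fin σ.cardY → ℝ}
    {W : Fin σ.cardZ → Fin σ.cardY → 𝒳 → ℝ} (hV : ∀ z, ∑ y, V z y = 1)
    (hW : ∀ z y, ∑ x, W z y x = 1)
    (hq : ∀ x y z, σ.pXYZ.1 (x, y, z) = s z * V z y * W z y x) :
    σ.infoXZ * Real.log 2
      = natEntropy p - ∑ z, s z * natEntropy fun x => ∑ y, V z y * W z y x := by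
  have h := mutualInfo_mul_log_two
    (q := fun t : 𝒳 × Fin σ.cardZ => ∑ y, σ.pXYZ.1 (t.1, y, t.2))
    (r := s) (W := fun z x => ∑ y, V z y * W z y x)
    (fun z => by
      rw [Finset.sum_comm]
      simp_rw [← Finset.mul_sum, hW, mul_one, hV])
    fun u z => by simp_rw [hq, Finset.mul_sum, mul_assoc]
  unfold ProductExtension.infoXZ
  rw [h]
  congr 2
  ext x
  rw [← hp x, Fintype.sum_prod_type, Finset.sum_comm]

/-- Every rate pair dominating the informations of a product extension is achievable. -/
theorem achievable_of_mem_cascadeExtensions {p : stdSimplex ℝ 𝒳} {ω : 𝒳 → State (α × β × γ)}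
    {σ : ProductExtension 𝒳 α β γ} (hσ : σ ∈ cascadeExtensions p ω) {R : ℝ × ℝ}
    (h₁ : σ.infoXYZ ≤ R.1) (h₂ : σ.infoXZ ≤ R.2) : Achievable p ω R := by
  intro ε hε δ hδ
  have hl2 : 0 < Real.log 2 := Real.log_pos one_lt_two
  obtain ⟨s, V, W, hs, hV, hW, hq⟩ := exists_factorization σ.pXYZ.2
  have hpW : ∀ x, p.1 x = ∑ z, s z * ∑ y, V z y * W z y x := fun x => by
    rw [← sum_pXYZ_eq hσ, Fintype.sum_prod_type, Finset.sum_comm]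
    simp_rw [hq, Finset.mul_sum, mul_assoc]
  have hI := infoXYZ_mul_log_two (sum_pXYZ_eq hσ) (fun z y => (hW z y).2) hq
  have hJ := infoXZ_mul_log_two (sum_pXYZ_eq hσ) (fun z => (hV z).2) (fun z y => (hW z y).2) hq
  set D : ℝ := (Fintype.card (𝒳 × α × β × γ) : ℝ) ^ 2 with hD
  have hD0 : 0 ≤ D := by positivity
  have hε' : 0 < ε / (2 * (D + 1)) := by positivity
  obtain ⟨N, hN⟩ := exists_codebook_of_rates hs hV hW p.2 hpW hI hJ hε' (mul_pos hδ hl2)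
  refine ⟨N, fun n hn => ?_⟩
  obtain ⟨hn0, M, K, hM, hK, hMle, hMKle, cb, hcb⟩ := hN n hn
  obtain ⟨L, hL, hPbar⟩ := exists_encoder hs hV hW p.2 hn0 hM hK cb hcb
  have hrate : ∀ {I r : ℝ}, I ≤ r →
      Real.exp (n * (I * Real.log 2 + δ * Real.log 2)) ≤ (2 : ℝ) ^ ((n : ℝ) * (r + δ)) := by
    intro I r h
    rw [Real.rpow_def_of_pos two_pos, Real.exp_le_exp]
    have : (n : ℝ) * (I + δ) * Real.log 2 ≤ (n : ℝ) * (r + δ) * Real.log 2 := by gcongr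
    linarith
  have hM1 : M * K ≤ ⌊(2 : ℝ) ^ ((n : ℝ) * (R.1 + δ))⌋₊ := Nat.le_floor <| by
    push_cast
    exact hMKle.trans (hrate h₁)
  have hM2 : M ≤ ⌊(2 : ℝ) ^ ((n : ℝ) * (R.2 + δ))⌋₊ := Nat.le_floor (hMle.trans (hrate h₂))
  obtain ⟨co, hco⟩ := exists_code_of_encoder p σ.stateA σ.stateB σ.stateC hM hK hM1 hM2 cb L hL
  refine ⟨co, ?_⟩
  have hσ' : traceYZ σ.cqState = extendedState p ω := hσ
  refine (traceNorm_le_of_forall_norm_le _ (by positivity : 0 ≤ 2 * (ε / (2 * (D + 1))))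
    ?_).trans ?_
  · rintro ⟨x, a, b, c⟩ ⟨x', a', b', c'⟩
    rw [Matrix.sub_apply, hco, ← hσ', traceYZ_cqState_apply]
    split_ifs with hx
    swap
    · simp only [sub_zero, norm_zero]; positivity
    have hsum : ∑ y, ∑ z, (σ.pXYZ.1 (x, y, z) : ℂ) *
        ((σ.stateB y).1 b b' * (σ.stateC z).1 c c')
        = ∑ t : Fin σ.cardZ × Fin σ.cardY × 𝒳,
          ((s t.1 * V t.1 t.2.1 * W t.1 t.2.1 t.2.2 : ℝ) : ℂ) *
          (if t.2.2 = x then (σ.stateB t.2.1).1 b b' * (σ.stateC t.1).1 c c' else 0) := by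
      simp_rw [Fintype.sum_prod_type]
      rw [Finset.sum_comm]
      refine Finset.sum_congr rfl fun z _ => Finset.sum_congr rfl fun y _ => ?_
      rw [hq]
      simp
    rw [hsum, ← mul_sub, ← Finset.sum_sub_distrib, norm_mul]
    simp_rw [← sub_mul, ← Complex.ofReal_sub]
    refine (mul_le_of_le_one_left (norm_nonneg _) (State.norm_apply_le_one _ _ _)).trans ?_
    refine (norm_sum_le _ _).trans (le_trans (Finset.sum_le_sum fun t _ => ?_) hPbar)
    rw [norm_mul, Complex.norm_real, Real.norm_eq_abs]
    refine mul_le_of_le_one_right (abs_nonneg _) ?_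
    split_ifs
    · rw [norm_mul]
      exact mul_le_one₀ (State.norm_apply_le_one _ _ _) (norm_nonneg _)
        (State.norm_apply_le_one _ _ _)
    · simp
  · rw [← hD, show D * (2 * (ε / (2 * (D + 1)))) = ε * (D / (D + 1)) by field_simp]
    refine mul_le_of_le_one_right hε.le ?_
    rw [div_le_one (by positivity)]
    linarith

end Achievability

/-! ### The information bound for the converse -/

/-- Joint mass of the `i`-th source letter and the message. -/
def letterMessageLaw {X M : Type*} [Fintype X] [DecidableEq X] {n : ℕ} (p : X → ℝ)
    (a : (Fin n → X) → M → ℝ) (i : Fin n) (x : X) (m : M) : ℝ :=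
  ∑ w : Fin n → X, if w i = x then (∏ j, p (w j)) * a w m else 0

section Converse

variable {X M : Type*} [Fintype X] [DecidableEq X] [Fintype M] {n : ℕ}

lemma letterMessageLaw_nonneg {p : X → ℝ} (hp : p ∈ stdSimplex ℝ X)
    {a : (Fin n → X) → M → ℝ} (ha : ∀ w, a w ∈ stdSimplex ℝ M) (i : Fin n) (x : X) (m : M) :
    0 ≤ letterMessageLaw p a i x m :=
  Finset.sum_nonneg fun w _ => by
    split_ifs
    · exact mul_nonneg (Finset.prod_nonneg fun j _ => hp.1 _) ((ha w).1 m)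
    · exact le_rfl

lemma sum_letterMessageLaw_mul {M : Type*} (p : X → ℝ) (a : (Fin n → X) → M → ℝ) (i : Fin n)
    (m : M) (f : X → ℝ) :
    ∑ x, letterMessageLaw p a i x m * f x = ∑ w : Fin n → X, (∏ j, p (w j)) * a w m * f (w i) := by
  unfold letterMessageLaw
  simp_rw [Finset.sum_mul]
  rw [Finset.sum_comm]
  simp

lemma sum_letterMessageLaw {M : Type*} (p : X → ℝ) (a : (Fin n → X) → M → ℝ) (i : Fin n)
    (m : M) : ∑ x, letterMessageLaw p a i x m = ∑ w : Fin n → X, (∏ j, p (w j)) * a w m := by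
  simpa using sum_letterMessageLaw_mul p a i m fun _ => 1

lemma sum_message_letterMessageLaw {p : X → ℝ} (hp : p ∈ stdSimplex ℝ X)
    {a : (Fin n → X) → M → ℝ} (ha : ∀ w, a w ∈ stdSimplex ℝ M) (i : Fin n) (x : X) :
    ∑ m, letterMessageLaw p a i x m = p x := by
  unfold letterMessageLaw
  rw [Finset.sum_comm]
  have h : ∀ w : Fin n → X, ∑ m, (if w i = x then (∏ j, p (w j)) * a w m else 0)
      = (∏ j, p (w j)) * if w i = x then 1 else 0 := fun w => by
    split_ifs
    · rw [← Finset.mul_sum, (ha w).2]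
    · simp
  simp_rw [h]
  rw [sum_prod_mul_apply (fun _ => p) (fun _ => hp.2) i fun y => if y = x then 1 else 0]
  simp

/-- A message with `|M|` values carries at most `log |M|` nats about an i.i.d. source, even when
the information is counted letter by letter. Summed over words `w` and messages `m`, the product
law `∏ᵢ q i m (wᵢ) / |M|` has total mass one and the source law dominates the joint law, so the
claim is `log t ≤ t - 1` for the likelihood ratio of these two. -/
theorem card_mul_natEntropy_sub_le {p : X → ℝ} (hp : p ∈ stdSimplex ℝ X)
    {a : (Fin n → X) → M → ℝ} (ha : ∀ w, a w ∈ stdSimplex ℝ M)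
    {q : Fin n → M → X → ℝ} (hq : ∀ i m, q i m ∈ stdSimplex ℝ X)
    (hJ : ∀ i x m, letterMessageLaw p a i x m
      = (∑ w : Fin n → X, (∏ j, p (w j)) * a w m) * q i m x) :
    n * natEntropy p - ∑ i, ∑ m, (∑ w : Fin n → X, (∏ j, p (w j)) * a w m) * natEntropy (q i m)
      ≤ Real.log (Fintype.card M) := by
  have hpn := prod_mem_stdSimplex (ι := Fin n) fun _ => hp
  have hwne : Nonempty (Fin n → X) := by
    by_contra h
    rw [not_nonempty_iff] at h
    simpa using hpn.2
  have hMne : Nonempty M := by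
    obtain ⟨w⟩ := hwne
    by_contra h
    rw [not_nonempty_iff] at h
    simpa using (ha w).2
  have hc : (0 : ℝ) < Fintype.card M := by exact_mod_cast Fintype.card_pos
  set K : (Fin n → X) → M → ℝ := fun w m => (∏ j, p (w j)) * a w m with hK
  have hK0 : ∀ w m, 0 ≤ K w m := fun w m => mul_nonneg (hpn.1 w) ((ha w).1 m)
  have hKsum : ∑ w, ∑ m, K w m = 1 := by
    simp_rw [hK, ← Finset.mul_sum, (ha _).2, mul_one]; exact hpn.2
  have hterm : ∀ w m, K w m * ((∑ i, (Real.log (q i m (w i)) - Real.log (p (w i))))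
      - Real.log (Fintype.card M)) ≤ (∏ i, q i m (w i)) / Fintype.card M - K w m := by
    intro w m
    have hq0 : 0 ≤ ∏ i, q i m (w i) := Finset.prod_nonneg fun i _ => (hq i m).1 _
    rcases (hK0 w m).eq_or_lt with h0 | hpos
    · rw [← h0, zero_mul, sub_zero]; positivity
    have hpw : 0 < ∏ j, p (w j) := lt_of_le_of_ne (hpn.1 w) fun h => hpos.ne' (by
      simp only [hK]; rw [← h, zero_mul])
    have hpi : ∀ i, 0 < p (w i) := fun i => lt_of_le_of_ne (hp.1 _) fun h =>
      hpw.ne' (Finset.prod_eq_zero (Finset.mem_univ i) h.symm)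
    have hqi : ∀ i, 0 < q i m (w i) := fun i => by
      refine lt_of_le_of_ne ((hq i m).1 _) fun h => ?_
      have h1 := hJ i (w i) m
      rw [← h, mul_zero] at h1
      have h2 : K w m ≤ letterMessageLaw p a i (w i) m := by
        unfold letterMessageLaw
        refine le_trans (le_of_eq ?_) (Finset.single_le_sum (f := fun w' : Fin n → X =>
          if w' i = w i then (∏ j, p (w' j)) * a w' m else 0) (fun w' _ => ?_)
          (Finset.mem_univ w))
        · simp [hK]
        · split_ifs
          exacts [hK0 w' m, le_rfl]
      linarith
    set t := (∏ i, q i m (w i)) / ((∏ j, p (w j)) * Fintype.card M) with ht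
    have hqp : 0 < ∏ i, q i m (w i) := Finset.prod_pos fun i _ => hqi i
    have htpos : 0 < t := by positivity
    have hlog : (∑ i, (Real.log (q i m (w i)) - Real.log (p (w i))))
        - Real.log (Fintype.card M) = Real.log t := by
      rw [ht, Real.log_div hqp.ne' (by positivity), Real.log_mul hpw.ne' hc.ne',
        Real.log_prod fun i _ => (hqi i).ne', Real.log_prod fun i _ => (hpi i).ne',
        Finset.sum_sub_distrib]
      ring
    rw [hlog]
    have h1 := mul_le_mul_of_nonneg_left (Real.log_le_sub_one_of_pos htpos) hpos.le
    have h2 : K w m * t = a w m * ((∏ i, q i m (w i)) / Fintype.card M) := by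
      rw [ht]; simp only [hK]; field_simp
    have ha1 : a w m ≤ 1 := by
      rw [← (ha w).2]
      exact Finset.single_le_sum (fun m _ => (ha w).1 m) (Finset.mem_univ m)
    have h3 := mul_le_of_le_one_left (div_nonneg hq0 hc.le) ha1
    linarith
  have hsum := Finset.sum_le_sum fun w (_ : w ∈ Finset.univ) =>
    Finset.sum_le_sum fun m (_ : m ∈ Finset.univ) => hterm w m
  have hq1 : ∑ w : Fin n → X, ∑ m, (∏ i, q i m (w i)) / (Fintype.card M : ℝ) = 1 := by
    rw [Finset.sum_comm]
    simp_rw [← Finset.sum_div]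
    rw [Finset.sum_congr rfl fun m _ => (prod_mem_stdSimplex fun i => hq i m).2]
    simp [hc.ne']
  simp_rw [mul_sub, Finset.sum_sub_distrib, hq1, hKsum, ← Finset.sum_mul, hKsum, mul_sub,
    Finset.sum_sub_distrib] at hsum
  have e1 : ∑ w, ∑ m, K w m * ∑ i, Real.log (q i m (w i))
      = -∑ i, ∑ m, (∑ w : Fin n → X, K w m) * natEntropy (q i m) := by
    rw [← Finset.sum_neg_distrib]
    simp_rw [Finset.mul_sum (s := (Finset.univ : Finset (Fin n)))]
    rw [Finset.sum_congr rfl fun w _ => Finset.sum_comm, Finset.sum_comm]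
    refine Finset.sum_congr rfl fun i _ => ?_
    rw [Finset.sum_comm, ← Finset.sum_neg_distrib]
    refine Finset.sum_congr rfl fun m _ => ?_
    rw [← sum_letterMessageLaw_mul p a i m fun x => Real.log (q i m x)]
    simp_rw [hJ, natEntropy, Real.negMulLog, Finset.mul_sum, ← Finset.sum_neg_distrib]
    exact Finset.sum_congr rfl fun x _ => by ring
  have e2 : ∑ w, ∑ m, K w m * ∑ i, Real.log (p (w i)) = -(n * natEntropy p) := by
    simp_rw [← Finset.sum_mul, hK, ← Finset.mul_sum, (ha _).2, mul_one, Finset.mul_sum]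
    rw [Finset.sum_comm]
    rw [Finset.sum_congr rfl fun i _ =>
      sum_prod_mul_apply (fun _ => p) (fun _ => hp.2) i fun x => Real.log (p x)]
    simp [natEntropy, Real.negMulLog]
  linarith

end Converse

/-! ### The single-letter region as a projection of a compact convex set -/

/-- In finite dimension the convex hull of a compact set is compact: by Carathéodory's theorem it is
the image of a simplex times a power of the set. -/
theorem isCompact_convexHull_of_finiteDimensional {E : Type*} [AddCommGroup E] [Module ℝ E]
    [TopologicalSpace E] [ContinuousAdd E] [ContinuousSMul ℝ E] [FiniteDimensional ℝ E]
    {s : Set E} (hs : IsCompact s) : IsCompact (convexHull ℝ s) := by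
  rcases s.eq_empty_or_nonempty with rfl | ⟨e₀, he₀⟩
  · simp
  set d := Module.finrank ℝ E + 1 with hd
  have himg : convexHull ℝ s = (fun f : (Fin d → ℝ) × (Fin d → E) => ∑ i, f.1 i • f.2 i) ''
      (stdSimplex ℝ (Fin d) ×ˢ Set.pi Set.univ fun _ => s) := by
    ext v
    constructor
    · intro hv
      obtain ⟨ι, _, z, w, hz, hind, hw0, hw1, rfl⟩ := eq_pos_convex_span_of_mem_convexHull hv
      have hcard : Fintype.card ι ≤ d := by
        have h1 := hind.card_le_finrank_succ
        have h2 := Submodule.finrank_le (vectorSpan ℝ (Set.range z))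
        omega
      -- pad the weights by zeros and the points by `e₀`
      let e : ι → Fin d := fun i => Fin.castLE hcard (Fintype.equivFin ι i)
      have he : Function.Injective e :=
        (Fin.castLE_injective hcard).comp (Fintype.equivFin ι).injective
      refine ⟨(Function.extend e w 0, Function.extend e z fun _ => e₀), ⟨⟨fun j => ?_, ?_⟩,
        fun j _ => ?_⟩, ?_⟩
      · by_cases h : ∃ i, e i = j
        · obtain ⟨i, rfl⟩ := h
          simpa only [he.extend_apply] using (hw0 i).le
        · simp only [Function.extend_apply' _ _ _ h]; exact le_rfl
      · rw [← hw1, ← Finset.sum_subset (Finset.subset_univ (Finset.univ.image e)),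
          Finset.sum_image he.injOn]
        · simp [he.extend_apply]
        · intro j _ hj
          dsimp only
          rw [Function.extend_apply']
          · rfl
          · rintro ⟨i, rfl⟩
            exact hj (Finset.mem_image_of_mem e (Finset.mem_univ i))
      · by_cases h : ∃ i, e i = j
        · obtain ⟨i, rfl⟩ := h
          simp only [he.extend_apply]; exact hz ⟨i, rfl⟩
        · simp only [Function.extend_apply' _ _ _ h]; exact he₀
      · simp only
        rw [← Finset.sum_subset (Finset.subset_univ (Finset.univ.image e)),
          Finset.sum_image he.injOn]
        · simp [he.extend_apply]
        · intro j _ hj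
          rw [Function.extend_apply', Pi.zero_apply, zero_smul]
          rintro ⟨i, rfl⟩
          exact hj (Finset.mem_image_of_mem e (Finset.mem_univ i))
    · rintro ⟨⟨w, z⟩, ⟨hw, hz⟩, rfl⟩
      exact (convex_convexHull ℝ s).sum_mem (fun i _ => hw.1 i) hw.2
        fun i _ => subset_convexHull ℝ s (hz i (Set.mem_univ i))
  rw [himg]
  exact ((isCompact_stdSimplex ℝ (Fin d)).prod (isCompact_univ_pi fun _ => hs)).image (by fun_prop)

section Hull

variable {𝒳 β γ : Type*} [Fintype 𝒳] [Fintype β] [Fintype γ]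

/-- What one letter `y` contributes: the law of `X` given `y`, the operators
`p(x|y) σ_B^y`, and the conditional entropy. -/
def bobPoint (q : 𝒳 → ℝ) (ρ : Matrix β β ℂ) : (𝒳 → ℝ) × (𝒳 → Matrix β β ℂ) × ℝ :=
  (q, fun x => (q x : ℂ) • ρ, natEntropy q)

/-- What one letter `z` contributes, given the average `u` of the contributions of the letters `y`
that go with it: the law of `X` given `z`, the operators `∑ p(x,y|z) σ_B^y ⊗ σ_C^z`, and the entropy
of `X` given `YZ` and given `Z`. -/
def charliePoint (u : (𝒳 → ℝ) × (𝒳 → Matrix β β ℂ) × ℝ) (ρ : Matrix γ γ ℂ) :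
    (𝒳 → ℝ) × (𝒳 → Matrix (β × γ) (β × γ) ℂ) × ℝ × ℝ :=
  (u.1, fun x => u.2.1 x ⊗ₖ ρ, u.2.2, natEntropy u.1)

variable (𝒳 β) in
/-- All contributions of single letters `y`. -/
def bobSet : Set ((𝒳 → ℝ) × (𝒳 → Matrix β β ℂ) × ℝ) :=
  (fun v : (𝒳 → ℝ) × Matrix β β ℂ => bobPoint v.1 v.2) '' (stdSimplex ℝ 𝒳 ×ˢ stateSet β)

variable (𝒳 β γ) in
/-- All contributions of single letters `z`. -/
def charlieSet : Set ((𝒳 → ℝ) × (𝒳 → Matrix (β × γ) (β × γ) ℂ) × ℝ × ℝ) :=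
  (fun v : ((𝒳 → ℝ) × (𝒳 → Matrix β β ℂ) × ℝ) × Matrix γ γ ℂ => charliePoint v.1 v.2) ''
    (convexHull ℝ (bobSet 𝒳 β) ×ˢ stateSet γ)

lemma continuous_natEntropy : Continuous (natEntropy : (𝒳 → ℝ) → ℝ) := by
  unfold natEntropy
  exact continuous_finsetSum _ fun x _ => Real.continuous_negMulLog.comp (continuous_apply x)

variable (𝒳 β γ) in
lemma isCompact_convexHull_charlieSet : IsCompact (convexHull ℝ (charlieSet 𝒳 β γ)) := by
  have hB : IsCompact (bobSet 𝒳 β) := by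
    refine ((isCompact_stdSimplex ℝ 𝒳).prod (isCompact_stateSet β)).image ?_
    unfold bobPoint
    refine continuous_fst.prodMk (Continuous.prodMk ?_ (continuous_natEntropy.comp continuous_fst))
    refine continuous_pi fun x => ?_
    exact (Complex.continuous_ofReal.comp ((continuous_apply x).comp continuous_fst)).smul
      continuous_snd
  have hC : IsCompact (charlieSet 𝒳 β γ) := by
    refine ((isCompact_convexHull_of_finiteDimensional hB).prod (isCompact_stateSet γ)).image ?_
    unfold charliePoint
    have h1 : Continuous fun v : ((𝒳 → ℝ) × (𝒳 → Matrix β β ℂ) × ℝ) × Matrix γ γ ℂ => v.1.1 :=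
      continuous_fst.fst
    refine h1.prodMk (Continuous.prodMk ?_ (continuous_fst.snd.snd.prodMk
      (continuous_natEntropy.comp h1)))
    refine continuous_pi fun x => continuous_matrix fun i j => ?_
    simp only [Matrix.kroneckerMap_apply]
    exact (((continuous_apply x).comp continuous_fst.snd.fst).matrix_elem i.1 j.1).mul
      (continuous_snd.matrix_elem i.2 j.2)
  exact isCompact_convexHull_of_finiteDimensional hC

/-- A point of the hull, unfolded: letters `z` with weights `s`, and for each of them letters `y`,
arranged in one alphabet, with weights `V z`. -/
lemma exists_of_mem_convexHull_charlieSet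
    {k : (𝒳 → ℝ) × (𝒳 → Matrix (β × γ) (β × γ) ℂ) × ℝ × ℝ}
    (hk : k ∈ convexHull ℝ (charlieSet 𝒳 β γ)) :
    ∃ (Z Y : Type) (_ : Fintype Z) (_ : Fintype Y) (s : Z → ℝ) (V : Z → Y → ℝ)
      (W : Z → Y → 𝒳 → ℝ) (B : Y → State β) (C : Z → State γ),
      s ∈ stdSimplex ℝ Z ∧ (∀ z, V z ∈ stdSimplex ℝ Y) ∧ (∀ z y, W z y ∈ stdSimplex ℝ 𝒳) ∧
      (∀ x, k.1 x = ∑ z, s z * ∑ y, V z y * W z y x) ∧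
      (∀ x b b' c c', k.2.1 x (b, c) (b', c')
        = ∑ z, ∑ y, ((s z * V z y * W z y x : ℝ) : ℂ) * ((B y).1 b b' * (C z).1 c c')) ∧
      k.2.2.1 = ∑ z, s z * ∑ y, V z y * natEntropy (W z y) ∧
      k.2.2.2 = ∑ z, s z * natEntropy fun x => ∑ y, V z y * W z y x := by
  classical
  obtain ⟨Z, _, s, f, hs0, hs1, hf, rfl⟩ := mem_convexHull_iff_exists_fintype.1 hk
  choose g hg hgf using hf
  have hu := fun z => mem_convexHull_iff_exists_fintype.1 (hg z).1
  choose J _ v h hv0 hv1 hh hvh using hu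
  choose l hl hlh using hh
  -- the alphabets of the letters `y` depend on `z`; their disjoint union serves all `z` at once
  have hVsum : ∀ {R : Type} [AddCommMonoid R] (z : Z) (F : (Σ z, J z) → R),
      ∑ y : Σ z, J z, (if y.1 = z then F y else 0) = ∑ j, F ⟨z, j⟩ := by
    intro R _ z F
    rw [Fintype.sum_sigma, Finset.sum_eq_single z]
    · simp
    · intro z' _ hz'
      simp [hz']
    · simp
  have hg1 : ∀ z, (g z).1.1 = fun x => ∑ j, v z j * (l z j).1 x := fun z => by
    rw [← hvh z]
    ext x
    simp only [Prod.fst_sum, Prod.smul_fst, Finset.sum_apply, Pi.smul_apply, smul_eq_mul, ← hlh,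
      bobPoint]
  have hg2 : ∀ z x, (g z).1.2.1 x = ∑ j, v z j • (((l z j).1 x : ℂ) • (l z j).2) := fun z x => by
    rw [← hvh z]
    simp only [Prod.fst_sum, Prod.snd_sum, Prod.smul_fst, Prod.smul_snd, Finset.sum_apply,
      Pi.smul_apply, ← hlh, bobPoint]
  have hg3 : ∀ z, (g z).1.2.2 = ∑ j, v z j * natEntropy (l z j).1 := fun z => by
    rw [← hvh z]
    simp only [Prod.snd_sum, Prod.smul_snd, smul_eq_mul, ← hlh, bobPoint]
  have hmass : ∀ z x, ∑ y : Σ z, J z, (if y.1 = z then v y.1 y.2 else 0) * (l y.1 y.2).1 x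
      = (g z).1.1 x := fun z x => by
    simp_rw [ite_mul, zero_mul]
    rw [hVsum z fun y => v y.1 y.2 * (l y.1 y.2).1 x, hg1]
  refine ⟨Z, Σ z, J z, inferInstance, inferInstance, s,
    fun z y => if y.1 = z then v y.1 y.2 else 0, fun _ y => (l y.1 y.2).1,
    fun y => ⟨(l y.1 y.2).2, (hl y.1 y.2).2⟩, fun z => ⟨(g z).2, (hg z).2⟩, ⟨hs0, hs1⟩,
    fun z => ⟨fun y => ?_, ?_⟩, fun z y => (hl y.1 y.2).1, fun x => ?_, fun x b b' c c' => ?_,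
    ?_, ?_⟩
  · dsimp only
    split_ifs
    exacts [hv0 _ _, le_rfl]
  · rw [hVsum z fun y => v y.1 y.2]
    exact hv1 z
  · simp only [Prod.fst_sum, Prod.smul_fst, Finset.sum_apply, Pi.smul_apply, smul_eq_mul, ← hgf,
      charliePoint, hmass]
  · simp only [Prod.fst_sum, Prod.snd_sum, Prod.smul_fst, Prod.smul_snd, Finset.sum_apply,
      Pi.smul_apply, ← hgf, charliePoint, Matrix.sum_apply, Matrix.smul_apply,
      Matrix.kroneckerMap_apply, hg2, Complex.real_smul, smul_eq_mul]
    refine Finset.sum_congr rfl fun z _ => ?_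
    have h1 : ∀ y : Σ z, J z, ((s z * (if y.1 = z then v y.1 y.2 else 0) * (l y.1 y.2).1 x : ℝ) : ℂ)
        * ((l y.1 y.2).2 b b' * (g z).2 c c') = if y.1 = z then ((s z * v y.1 y.2
          * (l y.1 y.2).1 x : ℝ) : ℂ) * ((l y.1 y.2).2 b b' * (g z).2 c c') else 0 := fun y => by
      split_ifs <;> simp
    simp_rw [h1]
    rw [hVsum z fun y => ((s z * v y.1 y.2 * (l y.1 y.2).1 x : ℝ) : ℂ)
      * ((l y.1 y.2).2 b b' * (g z).2 c c'), Finset.sum_mul, Finset.mul_sum]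
    refine Finset.sum_congr rfl fun j _ => ?_
    push_cast
    ring
  · simp only [Prod.fst_sum, Prod.snd_sum, Prod.smul_fst, Prod.smul_snd, smul_eq_mul, ← hgf,
      charliePoint, hg3]
    refine Finset.sum_congr rfl fun z _ => ?_
    simp_rw [ite_mul, zero_mul]
    rw [hVsum z fun y => v y.1 y.2 * natEntropy (l y.1 y.2).1]
  · simp only [Prod.snd_sum, Prod.smul_snd, smul_eq_mul, ← hgf, charliePoint, hmass]

end Hull

/-- Product extensions from a factorized law on arbitrary finite alphabets. -/
lemma exists_extension_of_factorization {𝒳 α β γ : Type*} [Fintype 𝒳] [DecidableEq 𝒳] [Fintype α]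
    [Fintype β] [Fintype γ] {Y Z : Type*} [Fintype Y] [Fintype Z] {p : 𝒳 → ℝ}
    {s : Z → ℝ} {V : Z → Y → ℝ} {W : Z → Y → 𝒳 → ℝ}
    (hs : s ∈ stdSimplex ℝ Z) (hV : ∀ z, V z ∈ stdSimplex ℝ Y)
    (hW : ∀ z y, W z y ∈ stdSimplex ℝ 𝒳)
    (hpW : ∀ x, p x = ∑ z, s z * ∑ y, V z y * W z y x)
    (A : 𝒳 → State α) (B : Y → State β) (C : Z → State γ) :
    ∃ σ : ProductExtension 𝒳 α β γ,
      (∀ x x' a a' b b' c c', traceYZ σ.cqState (x, a, b, c) (x', a', b', c') = if x = x' then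
        (A x).1 a a' * ∑ z, ∑ y, ((s z * V z y * W z y x : ℝ) : ℂ) *
          ((B y).1 b b' * (C z).1 c c') else 0) ∧
      σ.infoXYZ * Real.log 2 = natEntropy p - ∑ z, s z * ∑ y, V z y * natEntropy (W z y) ∧
      σ.infoXZ * Real.log 2
        = natEntropy p - ∑ z, s z * natEntropy fun x => ∑ y, V z y * W z y x := by
  let eY := (Fintype.equivFin Y).symm
  let eZ := (Fintype.equivFin Z).symm
  have hsumY : ∀ {R : Type} [AddCommMonoid R] (F : Y → R), ∑ y, F (eY y) = ∑ y, F y :=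
    fun F => Equiv.sum_comp eY F
  have hsumZ : ∀ {R : Type} [AddCommMonoid R] (F : Z → R), ∑ z, F (eZ z) = ∑ z, F z :=
    fun F => Equiv.sum_comp eZ F
  let q : 𝒳 × Fin (Fintype.card Y) × Fin (Fintype.card Z) → ℝ := fun t =>
    s (eZ t.2.2) * V (eZ t.2.2) (eY t.2.1) * W (eZ t.2.2) (eY t.2.1) t.1
  have hqX : ∀ x, ∑ v, q (x, v) = p x := fun x => by
    rw [Fintype.sum_prod_type, Finset.sum_comm, hpW]
    simp only [q]
    rw [hsumZ fun z => ∑ y, s z * V z (eY y) * W z (eY y) x]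
    refine Finset.sum_congr rfl fun z _ => ?_
    rw [hsumY fun y => s z * V z y * W z y x, Finset.mul_sum]
    exact Finset.sum_congr rfl fun y _ => by ring
  have hq : q ∈ stdSimplex ℝ _ := by
    refine ⟨fun t => mul_nonneg (mul_nonneg (hs.1 _) ((hV _).1 _)) ((hW _ _).1 _), ?_⟩
    rw [Fintype.sum_prod_type]
    simp_rw [hqX, hpW]
    rw [Finset.sum_comm]
    simp_rw [← Finset.mul_sum]
    rw [← hs.2]
    refine Finset.sum_congr rfl fun z _ => ?_
    rw [Finset.sum_comm]
    simp_rw [← Finset.mul_sum, (hW _ _).2, mul_one, (hV _).2, mul_one]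
  let σ : ProductExtension 𝒳 α β γ :=
    { cardY := Fintype.card Y
      cardZ := Fintype.card Z
      pXYZ := ⟨q, hq⟩
      stateA := A
      stateB := fun y => B (eY y)
      stateC := fun z => C (eZ z) }
  refine ⟨σ, fun x x' a a' b b' c c' => ?_, ?_, ?_⟩
  · rw [traceYZ_cqState_apply]
    refine if_congr Iff.rfl (congrArg _ ?_) rfl
    rw [Finset.sum_comm]
    refine (hsumZ fun z => ∑ y, ((s z * V z (eY y) * W z (eY y) x : ℝ) : ℂ) *
      ((B (eY y)).1 b b' * (C z).1 c c')).trans ?_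
    exact Finset.sum_congr rfl fun z _ => hsumY fun y => ((s z * V z y * W z y x : ℝ) : ℂ) *
      ((B y).1 b b' * (C z).1 c c')
  · rw [infoXYZ_mul_log_two (σ := σ) hqX (s := fun z => s (eZ z))
      (V := fun z y => V (eZ z) (eY y)) (W := fun z y => W (eZ z) (eY y))
      (fun z y => (hW _ _).2) fun x y z => rfl]
    congr 1
    refine (hsumZ fun z => s z * ∑ y, V z (eY y) * natEntropy (W z (eY y))).trans ?_
    exact Finset.sum_congr rfl fun z _ =>
      congrArg _ (hsumY fun y => V z y * natEntropy (W z y))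
  · rw [infoXZ_mul_log_two (σ := σ) hqX (s := fun z => s (eZ z))
      (V := fun z y => V (eZ z) (eY y)) (W := fun z y => W (eZ z) (eY y))
      (fun z => (hsumY fun y => V (eZ z) y).trans (hV _).2)
      (fun z y => (hW _ _).2) fun x y z => rfl]
    congr 1
    refine (hsumZ fun z => s z * natEntropy fun x => ∑ y, V z (eY y) * W z (eY y) x).trans ?_
    refine Finset.sum_congr rfl fun z _ => ?_
    congr 2
    ext x
    exact hsumY fun y => V z y * W z y x

/-! ### Converse -/

section CodeToPoint

variable {𝒳 α β γ : Type*} [Fintype 𝒳] [DecidableEq 𝒳] [Fintype α] [DecidableEq α]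
  [Fintype β] [DecidableEq β] [Fintype γ] [DecidableEq γ]

lemma sum_comm_four {I J K L : Type*} [Fintype I] [Fintype J] [Fintype K] [Fintype L]
    (f : I → J → K → L → ℂ) :
    ∑ i, ∑ j, ∑ k, ∑ l, f i j k l = ∑ l, ∑ k, ∑ j, ∑ i, f i j k l := by
  calc ∑ i, ∑ j, ∑ k, ∑ l, f i j k l = ∑ i, ∑ l, ∑ k, ∑ j, f i j k l := by
        refine Finset.sum_congr rfl fun i _ => ?_
        rw [Finset.sum_congr rfl fun j _ => Finset.sum_comm, Finset.sum_comm]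
        exact Finset.sum_congr rfl fun l _ => Finset.sum_comm
    _ = _ := by
        rw [Finset.sum_comm]
        refine Finset.sum_congr rfl fun l _ => ?_
        rw [Finset.sum_comm]
        exact Finset.sum_congr rfl fun k _ => Finset.sum_comm

/-- Single-letterization. With `Y = (M₁, I)` and `Z = (M₂, I)` for a uniform position `I`, a code
of block length `n` gives a point of the hull that has exactly its average state, and whose
informations are at most `1/n` of the logarithms of the message set sizes. -/
theorem exists_point_of_code {M₁ M₂ n : ℕ} (hn : 0 < n) (co : CascadeCode 𝒳 α β γ M₁ M₂ n)
    (p : stdSimplex ℝ 𝒳) :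
    ∃ k ∈ convexHull ℝ (charlieSet 𝒳 β γ), k.1 = p.1 ∧
      (∀ x x' a a' b b' c c', co.averageState p (x, a, b, c) (x', a', b', c') = if x = x' then
        (co.encA x).1 a a' * k.2.1 x (b, c) (b', c') else 0) ∧
      n * (natEntropy p.1 - k.2.2.1) ≤ Real.log M₁ ∧
      n * (natEntropy p.1 - k.2.2.2) ≤ Real.log M₂ := by
  have hn' : (n : ℝ) ≠ 0 := by positivity
  have hXne : Nonempty 𝒳 := by
    by_contra h
    rw [not_nonempty_iff] at h
    simpa using p.2.2
  set a₁ : (Fin n → 𝒳) → Fin M₁ → ℝ := fun w => (co.alice w).1 with ha₁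
  set a₂ : (Fin n → 𝒳) → Fin M₂ → ℝ := fun w m₂ => ∑ m₁, (co.alice w).1 m₁ * (co.bob m₁).1 m₂
    with ha₂
  have ha₁' : ∀ w, a₁ w ∈ stdSimplex ℝ (Fin M₁) := fun w => (co.alice w).2
  have ha₂' : ∀ w, a₂ w ∈ stdSimplex ℝ (Fin M₂) := fun w => by
    refine ⟨fun m₂ => Finset.sum_nonneg fun m₁ _ =>
      mul_nonneg ((co.alice w).2.1 _) ((co.bob m₁).2.1 _), ?_⟩
    simp only [ha₂]
    rw [Finset.sum_comm]
    simp_rw [← Finset.mul_sum, (co.bob _).2.2, mul_one]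
    exact (co.alice w).2.2
  have hMne : Nonempty (Fin M₁) := by
    by_contra h
    rw [not_nonempty_iff] at h
    simpa using (co.alice fun _ => hXne.some).2.2
  choose q₁ hq₁ hJ₁ using fun i : Fin n =>
    exists_kernel (letterMessageLaw p.1 a₁ i) fun x m => letterMessageLaw_nonneg p.2 ha₁' i x m
  choose q₂ hq₂ hJ₂ using fun i : Fin n =>
    exists_kernel (letterMessageLaw p.1 a₂ i) fun x m => letterMessageLaw_nonneg p.2 ha₂' i x m
  simp_rw [sum_letterMessageLaw] at hJ₁ hJ₂
  set P₁ : Fin M₁ → ℝ := fun m => ∑ w : Fin n → 𝒳, (∏ j, p.1 (w j)) * a₁ w m with hP₁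
  set P₂ : Fin M₂ → ℝ := fun m => ∑ w : Fin n → 𝒳, (∏ j, p.1 (w j)) * a₂ w m with hP₂
  replace hJ₁ : ∀ i x m, letterMessageLaw p.1 a₁ i x m = P₁ m * q₁ i m x := hJ₁
  replace hJ₂ : ∀ i x m, letterMessageLaw p.1 a₂ i x m = P₂ m * q₂ i m x := hJ₂
  have hpn := prod_mem_stdSimplex (ι := Fin n) fun _ => p.2
  have hP₁0 : ∀ m, 0 ≤ P₁ m := fun m => Finset.sum_nonneg fun w _ =>
    mul_nonneg (hpn.1 w) ((ha₁' w).1 m)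
  have hP₂0 : ∀ m, 0 ≤ P₂ m := fun m => Finset.sum_nonneg fun w _ =>
    mul_nonneg (hpn.1 w) ((ha₂' w).1 m)
  have hP₂1 : ∑ m, P₂ m = 1 := by
    simp only [hP₂]
    rw [Finset.sum_comm]
    simp_rw [← Finset.mul_sum, (ha₂' _).2, mul_one]
    exact hpn.2
  -- the backward law of Alice's message given Bob's
  obtain ⟨lam, hlam, hP₁₂⟩ := exists_kernel (fun m₁ m₂ => P₁ m₁ * (co.bob m₁).1 m₂)
    fun m₁ m₂ => mul_nonneg (hP₁0 m₁) ((co.bob m₁).2.1 m₂)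
  have hP₂eq : ∀ m₂, ∑ m₁, P₁ m₁ * (co.bob m₁).1 m₂ = P₂ m₂ := fun m₂ => by
    simp only [hP₁, hP₂, ha₁, ha₂, Finset.sum_mul, Finset.mul_sum]
    rw [Finset.sum_comm]
    simp_rw [mul_assoc]
  simp_rw [hP₂eq] at hP₁₂
  set u : Fin M₂ → Fin n → (𝒳 → ℝ) × (𝒳 → Matrix β β ℂ) × ℝ := fun m₂ i =>
    ∑ m₁, lam m₂ m₁ • bobPoint (q₁ i m₁) (reduced (co.encB m₁).1 i) with hu
  have hmem : ∀ m₂ i, u m₂ i ∈ convexHull ℝ (bobSet 𝒳 β) := fun m₂ i =>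
    (convex_convexHull ℝ _).sum_mem (fun m₁ _ => (hlam m₂).1 m₁) (hlam m₂).2 fun m₁ _ =>
      subset_convexHull ℝ _ ⟨(q₁ i m₁, reduced (co.encB m₁).1 i),
        ⟨hq₁ i m₁, reduced_mem_stateSet _ i⟩, rfl⟩
  -- summation over the backward law, weighted by Bob's message, is summation over the joint law
  have hsum : ∀ F : Fin n → Fin M₁ → Fin M₂ → ℝ,
      ∑ i : Fin n, ∑ m₂, ((n : ℝ)⁻¹ * P₂ m₂) * ∑ m₁, lam m₂ m₁ * F i m₁ m₂
        = (n : ℝ)⁻¹ * ∑ i, ∑ m₁, ∑ m₂, P₁ m₁ * (co.bob m₁).1 m₂ * F i m₁ m₂ := fun F => by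
    have h : ∀ i m₂, ((n : ℝ)⁻¹ * P₂ m₂) * ∑ m₁, lam m₂ m₁ * F i m₁ m₂
        = (n : ℝ)⁻¹ * ∑ m₁, P₁ m₁ * (co.bob m₁).1 m₂ * F i m₁ m₂ := fun i m₂ => by
      simp_rw [hP₁₂, mul_assoc, ← Finset.mul_sum]
    simp_rw [h, ← Finset.mul_sum]
    exact congrArg _ (Finset.sum_congr rfl fun i _ => Finset.sum_comm)
  have hu1 : ∀ m₂ i, (u m₂ i).1 = fun x => ∑ m₁, lam m₂ m₁ * q₁ i m₁ x := fun m₂ i => by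
    ext x
    simp only [hu, Prod.fst_sum, Prod.smul_fst, Finset.sum_apply, Pi.smul_apply, smul_eq_mul,
      bobPoint]
  have hu2 : ∀ m₂ i x, (u m₂ i).2.1 x
      = ∑ m₁, lam m₂ m₁ • ((q₁ i m₁ x : ℂ) • reduced (co.encB m₁).1 i) := fun m₂ i x => by
    simp only [hu, Prod.fst_sum, Prod.snd_sum, Prod.smul_fst, Prod.smul_snd, Finset.sum_apply,
      Pi.smul_apply, bobPoint]
  have hu3 : ∀ m₂ i, (u m₂ i).2.2 = ∑ m₁, lam m₂ m₁ * natEntropy (q₁ i m₁) := fun m₂ i => by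
    simp only [hu, Prod.snd_sum, Prod.smul_snd, smul_eq_mul, bobPoint]
  -- by the Markov property, the mixture of the laws given Alice's message is the law given Bob's;
  -- a message of Bob's that never occurs has weight zero
  have hu1' : ∀ m₂ i, P₂ m₂ * natEntropy (u m₂ i).1 = P₂ m₂ * natEntropy (q₂ i m₂) :=
    fun m₂ i => by
    rcases (hP₂0 m₂).eq_or_lt with h0 | hpos
    · rw [← h0]; simp
    congr 2
    ext x
    refine mul_left_cancel₀ hpos.ne' ?_
    rw [← hJ₂, hu1, Finset.mul_sum]
    simp_rw [← mul_assoc, ← hP₁₂]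
    simp_rw [mul_right_comm _ _ (q₁ _ _ _), ← hJ₁]
    simp only [letterMessageLaw, Finset.sum_mul, ha₁, ha₂]
    rw [Finset.sum_comm]
    refine Finset.sum_congr rfl fun w _ => ?_
    split_ifs
    · simp_rw [Finset.mul_sum, mul_assoc]
    · simp
  set k : (𝒳 → ℝ) × (𝒳 → Matrix (β × γ) (β × γ) ℂ) × ℝ × ℝ :=
    ∑ v : Fin n × Fin M₂, ((n : ℝ)⁻¹ * P₂ v.2) •
      charliePoint (u v.2 v.1) (reduced (co.encC v.2).1 v.1) with hk
  refine ⟨k, ?_, ?_, ?_, ?_, ?_⟩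
  · refine (convex_convexHull ℝ _).sum_mem (fun v _ => by have := hP₂0 v.2; positivity) ?_
      fun v _ => subset_convexHull ℝ _ ⟨(u v.2 v.1, reduced (co.encC v.2).1 v.1),
        ⟨hmem _ _, reduced_mem_stateSet _ _⟩, rfl⟩
    rw [Fintype.sum_prod_type]
    simp_rw [← Finset.mul_sum, hP₂1]
    simp [hn']
  · ext x
    simp only [hk, Prod.fst_sum, Prod.smul_fst, Finset.sum_apply, Pi.smul_apply, smul_eq_mul,
      charliePoint, hu1]
    rw [Fintype.sum_prod_type, hsum fun i m₁ _ => q₁ i m₁ x]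
    simp_rw [← Finset.sum_mul, ← Finset.mul_sum, (co.bob _).2.2, mul_one, ← hJ₁,
      sum_message_letterMessageLaw p.2 ha₁']
    simp [hn']
  · intro x x' a a' b b' c c'
    rw [averageState_apply]
    refine if_congr Iff.rfl (congrArg _ ?_) rfl
    simp only [hk, Prod.fst_sum, Prod.snd_sum, Prod.smul_fst, Prod.smul_snd, Finset.sum_apply,
      Pi.smul_apply, charliePoint, Matrix.sum_apply, Matrix.smul_apply,
      Matrix.kroneckerMap_apply, hu2, Complex.real_smul, smul_eq_mul]
    rw [Fintype.sum_prod_type]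
    have hR : ∀ (i : Fin n) (m₂ : Fin M₂), (((n : ℝ)⁻¹ * P₂ m₂ : ℝ) : ℂ) *
        ((∑ m₁, (lam m₂ m₁ : ℂ) * ((q₁ i m₁ x : ℂ) * reduced (co.encB m₁).1 i b b')) *
          reduced (co.encC m₂).1 i c c')
        = ∑ m₁, ∑ w : Fin n → 𝒳, (n : ℂ)⁻¹ * if w i = x then
            (((∏ j, p.1 (w j)) * (co.alice w).1 m₁ * (co.bob m₁).1 m₂ : ℝ) : ℂ) *
            (reduced (co.encB m₁).1 i b b' * reduced (co.encC m₂).1 i c c') else 0 := by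
      intro i m₂
      rw [Finset.sum_mul, Finset.mul_sum]
      refine Finset.sum_congr rfl fun m₁ _ => ?_
      have h1 : P₂ m₂ * lam m₂ m₁ * q₁ i m₁ x = ∑ w : Fin n → 𝒳, if w i = x then
          (∏ j, p.1 (w j)) * (co.alice w).1 m₁ * (co.bob m₁).1 m₂ else 0 := by
        rw [← hP₁₂, mul_right_comm, ← hJ₁, letterMessageLaw, Finset.sum_mul]
        exact Finset.sum_congr rfl fun w _ => by split_ifs <;> simp [ha₁]
      calc _ = (n : ℂ)⁻¹ * (((P₂ m₂ * lam m₂ m₁ * q₁ i m₁ x : ℝ) : ℂ) *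
            (reduced (co.encB m₁).1 i b b' * reduced (co.encC m₂).1 i c c')) := by
            push_cast; ring
        _ = _ := by
            rw [h1, Complex.ofReal_sum, Finset.sum_mul, Finset.mul_sum]
            refine Finset.sum_congr rfl fun w _ => ?_
            split_ifs <;> simp
    simp_rw [hR]
    rw [sum_comm_four]
    refine Finset.sum_congr rfl fun w _ => Finset.sum_congr rfl fun m₁ _ => ?_
    refine Finset.sum_congr rfl fun m₂ _ => ?_
    rw [Finset.mul_sum, Finset.mul_sum]
    refine Finset.sum_congr rfl fun i _ => ?_
    split_ifs
    · ring
    · simp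
  · have h := card_mul_natEntropy_sub_le p.2 ha₁' hq₁ hJ₁
    rw [Fintype.card_fin] at h
    refine le_trans (le_of_eq ?_) h
    simp only [hk, Prod.snd_sum, Prod.fst_sum, Prod.smul_snd, Prod.smul_fst, smul_eq_mul,
      charliePoint, hu3]
    rw [Fintype.sum_prod_type, hsum fun i m₁ _ => natEntropy (q₁ i m₁)]
    simp_rw [← Finset.sum_mul, ← Finset.mul_sum, (co.bob _).2.2, mul_one]
    rw [mul_sub, mul_inv_cancel_left₀ hn']
  · have h := card_mul_natEntropy_sub_le p.2 ha₂' hq₂ hJ₂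
    rw [Fintype.card_fin] at h
    refine le_trans (le_of_eq ?_) h
    simp only [hk, Prod.snd_sum, Prod.smul_snd, smul_eq_mul, charliePoint]
    rw [Fintype.sum_prod_type]
    simp_rw [mul_assoc, hu1', ← Finset.mul_sum]
    rw [mul_sub, mul_inv_cancel_left₀ hn']

/-- The total violation, by a point of the hull and states for Alice, of the conditions that define
an extension of `ω` with informations at most `R`. -/
def extensionDefect (p : stdSimplex ℝ 𝒳) (ω : 𝒳 → State (α × β × γ)) (R : ℝ × ℝ)
    (v : ((𝒳 → ℝ) × (𝒳 → Matrix (β × γ) (β × γ) ℂ) × ℝ × ℝ) × (𝒳 → Matrix α α ℂ)) : ℝ :=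
  (∑ x, |v.1.1 x - p.1 x|)
    + (∑ x, ∑ a, ∑ a', ∑ i, ∑ j,
        ‖v.2 x a a' * v.1.2.1 x i j - (p.1 x : ℂ) * (ω x).1 (a, i) (a', j)‖)
    + max 0 (natEntropy p.1 - v.1.2.2.1 - R.1 * Real.log 2)
    + max 0 (natEntropy p.1 - v.1.2.2.2 - R.2 * Real.log 2)

/-- Exact extensions exist as soon as approximate ones do, by compactness of the hull. -/
theorem exists_extension_of_forall_defect_le {𝒳 α β γ : Type*} [Fintype 𝒳] [DecidableEq 𝒳]
    [Fintype α] [Fintype β] [Fintype γ] (p : stdSimplex ℝ 𝒳) (ω : 𝒳 → State (α × β × γ))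
    (R : ℝ × ℝ)
    (h : ∀ ε > 0, ∃ v ∈ (convexHull ℝ (charlieSet 𝒳 β γ)) ×ˢ
      (Set.pi Set.univ fun _ : 𝒳 => stateSet α), extensionDefect p ω R v ≤ ε) :
    ∃ σ ∈ cascadeExtensions p ω, σ.infoXYZ ≤ R.1 ∧ σ.infoXZ ≤ R.2 := by
  have hK := (isCompact_convexHull_charlieSet 𝒳 β γ).prod
    (isCompact_univ_pi fun _ : 𝒳 => isCompact_stateSet α)
  have hcont : Continuous (extensionDefect p ω R) := by
    unfold extensionDefect
    have h1 : Continuous fun v : ((𝒳 → ℝ) × (𝒳 → Matrix (β × γ) (β × γ) ℂ) × ℝ × ℝ) ×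
        (𝒳 → Matrix α α ℂ) => v.1.2.1 := continuous_fst.snd.fst
    have hent : Continuous fun v : ((𝒳 → ℝ) × (𝒳 → Matrix (β × γ) (β × γ) ℂ) × ℝ × ℝ) ×
        (𝒳 → Matrix α α ℂ) => v.1.1 := continuous_fst.fst
    have h2 : ∀ x i j, Continuous fun v : ((𝒳 → ℝ) × (𝒳 → Matrix (β × γ) (β × γ) ℂ) × ℝ × ℝ) ×
        (𝒳 → Matrix α α ℂ) => v.1.2.1 x i j := fun x i j =>
      ((continuous_apply x).comp h1).matrix_elem i j
    have h3 : ∀ x a a', Continuous fun v : ((𝒳 → ℝ) × (𝒳 → Matrix (β × γ) (β × γ) ℂ) × ℝ × ℝ) ×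
        (𝒳 → Matrix α α ℂ) => v.2 x a a' := fun x a a' =>
      ((continuous_apply x).comp continuous_snd).matrix_elem a a'
    fun_prop
  -- the defect attains its minimum on the compact hull, and the minimum is zero
  obtain ⟨v₁, hv₁, -⟩ := h 1 one_pos
  obtain ⟨v, hv, hmin⟩ := hK.exists_isMinOn ⟨v₁, hv₁⟩ hcont.continuousOn
  have hle : extensionDefect p ω R v ≤ 0 := by
    refine le_of_forall_pos_le_add fun ε hε => ?_
    obtain ⟨w, hw, hwε⟩ := h ε hε
    rw [zero_add]
    exact (hmin hw).trans hwε
  have e1 : 0 ≤ ∑ x, |v.1.1 x - p.1 x| := Finset.sum_nonneg fun x _ => abs_nonneg _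
  have e2 : 0 ≤ ∑ x, ∑ a, ∑ a', ∑ i, ∑ j,
        ‖v.2 x a a' * v.1.2.1 x i j - (p.1 x : ℂ) * (ω x).1 (a, i) (a', j)‖ := by positivity
  have e3 := le_max_left 0 (natEntropy p.1 - v.1.2.2.1 - R.1 * Real.log 2)
  have e4 := le_max_left 0 (natEntropy p.1 - v.1.2.2.2 - R.2 * Real.log 2)
  have e3' := le_max_right 0 (natEntropy p.1 - v.1.2.2.1 - R.1 * Real.log 2)
  have e4' := le_max_right 0 (natEntropy p.1 - v.1.2.2.2 - R.2 * Real.log 2)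
  unfold extensionDefect at hle
  have hl2 : 0 < Real.log 2 := Real.log_pos one_lt_two
  have f1 : ∀ x, v.1.1 x = p.1 x := fun x => by
    have h0 : ∑ x, |v.1.1 x - p.1 x| = 0 := by linarith
    have := (Finset.sum_eq_zero_iff_of_nonneg fun x _ => abs_nonneg _).1 h0 x (Finset.mem_univ x)
    linarith [abs_eq_zero.1 this]
  have f2 : ∀ x a a' i j, v.2 x a a' * v.1.2.1 x i j = (p.1 x : ℂ) * (ω x).1 (a, i) (a', j) := by
    intro x a a' i j
    have h0 : ∑ x, ∑ a, ∑ a', ∑ i, ∑ j,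
        ‖v.2 x a a' * v.1.2.1 x i j - (p.1 x : ℂ) * (ω x).1 (a, i) (a', j)‖ = 0 := by linarith
    simp_rw [← Fintype.sum_prod_type'] at h0
    have := (Finset.sum_eq_zero_iff_of_nonneg fun _ _ => norm_nonneg _).1 h0
      (x, a, a', i, j) (Finset.mem_univ _)
    exact sub_eq_zero.1 (norm_eq_zero.1 this)
  obtain ⟨Z, Y, _, _, s, V, W, B, C, hs, hV, hW, g1, g2, g3, g4⟩ :=
    exists_of_mem_convexHull_charlieSet hv.1
  obtain ⟨σ, hσ, hI, hJ⟩ := exists_extension_of_factorization (p := p.1) hs hV hW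
    (fun x => (f1 x).symm.trans (g1 x)) (fun x => (⟨v.2 x, hv.2 x (Set.mem_univ x)⟩ : State α)) B C
  refine ⟨σ, ?_, ?_, ?_⟩
  · change traceYZ σ.cqState = extendedState p ω
    ext ⟨x, a, b, c⟩ ⟨x', a', b', c'⟩
    rw [hσ, extendedState_apply]
    refine if_congr Iff.rfl ?_ rfl
    rw [← g2]
    exact f2 x a a' (b, c) (b', c')
  · refine le_of_mul_le_mul_right ?_ hl2
    rw [hI, ← g3]
    linarith
  · refine le_of_mul_le_mul_right ?_ hl2
    rw [hJ, ← g4]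
    linarith

lemma le_rate_mul_log_two_of_mul_le_log {n M : ℕ} (hn : 0 < n) {t r : ℝ}
    (hM : 0 < M) (hMr : M ≤ ⌊(2 : ℝ) ^ ((n : ℝ) * r)⌋₊) (h : n * t ≤ Real.log M) :
    t ≤ r * Real.log 2 := by
  have hn' : (0 : ℝ) < n := by exact_mod_cast hn
  have hM' : (0 : ℝ) < M := by exact_mod_cast hM
  have h1 : (M : ℝ) ≤ (2 : ℝ) ^ ((n : ℝ) * r) :=
    (Nat.cast_le.2 hMr).trans (Nat.floor_le (by positivity))
  have h2 := Real.log_le_log hM' h1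
  rw [Real.log_rpow two_pos, mul_assoc] at h2
  exact le_of_mul_le_mul_left (h.trans h2) hn'

/-- Limits of achievable rate pairs dominate the informations of some product extension. -/
theorem exists_extension_of_mem_capacityRegion {p : stdSimplex ℝ 𝒳} {ω : 𝒳 → State (α × β × γ)}
    {R : ℝ × ℝ} (hR : R ∈ capacityRegion p ω) :
    ∃ σ ∈ cascadeExtensions p ω, σ.infoXYZ ≤ R.1 ∧ σ.infoXZ ≤ R.2 := by
  refine exists_extension_of_forall_defect_le p ω R fun ε hε => ?_
  have hl2 : 0 < Real.log 2 := Real.log_pos one_lt_two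
  have hXne : Nonempty 𝒳 := by
    by_contra h
    rw [not_nonempty_iff] at h
    simpa using p.2.2
  set D : ℝ := Fintype.card 𝒳 * (Fintype.card α * (Fintype.card α *
    (Fintype.card (β × γ) * Fintype.card (β × γ)))) with hD
  have hD0 : 0 ≤ D := by positivity
  -- the defect consists of `D` entries of size `η`, and two rate excesses of `2 η` bits: one `η`
  -- from approximating `R` by achievable pairs, one from the rate slack of the code
  set η : ℝ := ε / (D + 4 * Real.log 2) with hη
  have hη0 : 0 < η := by positivity
  obtain ⟨R', hR', hdist⟩ := Metric.mem_closure_iff.1 hR η hη0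
  obtain ⟨N, hN⟩ := hR' η hη0 η hη0
  obtain ⟨co, hco⟩ := hN (N + 1) (by omega)
  obtain ⟨k, hk, hk1, hkavg, hk3, hk4⟩ := exists_point_of_code (by omega : 0 < N + 1) co p
  refine ⟨(k, fun x => (co.encA x).1), ⟨hk, fun x _ => (co.encA x).2⟩, ?_⟩
  have hd1 : R'.1 ≤ R.1 + η := by
    have := (le_max_left _ _).trans_lt (Prod.dist_eq (x := R) (y := R') ▸ hdist)
    rw [Real.dist_eq] at this
    linarith [(abs_lt.1 this).1]
  have hd2 : R'.2 ≤ R.2 + η := by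
    have := (le_max_right _ _).trans_lt (Prod.dist_eq (x := R) (y := R') ▸ hdist)
    rw [Real.dist_eq] at this
    linarith [(abs_lt.1 this).1]
  -- the message sets are nonempty because they carry probability laws
  have hM₁ : 0 < ⌊(2 : ℝ) ^ (((N + 1 : ℕ) : ℝ) * (R'.1 + η))⌋₊ := by
    by_contra h
    have h0 : ∑ m, (co.alice fun _ => hXne.some).1 m = 1 := (co.alice _).2.2
    have : IsEmpty (Fin ⌊(2 : ℝ) ^ (((N + 1 : ℕ) : ℝ) * (R'.1 + η))⌋₊) := by
      rw [Nat.eq_zero_of_not_pos h]; infer_instance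
    simp at h0
  have hM₂ : 0 < ⌊(2 : ℝ) ^ (((N + 1 : ℕ) : ℝ) * (R'.2 + η))⌋₊ := by
    by_contra h
    have h0 : ∑ m, (co.bob ⟨0, hM₁⟩).1 m = 1 := (co.bob _).2.2
    have : IsEmpty (Fin ⌊(2 : ℝ) ^ (((N + 1 : ℕ) : ℝ) * (R'.2 + η))⌋₊) := by
      rw [Nat.eq_zero_of_not_pos h]; infer_instance
    simp at h0
  have hb1 := le_rate_mul_log_two_of_mul_le_log (by omega : 0 < N + 1) hM₁ le_rfl hk3
  have hb2 := le_rate_mul_log_two_of_mul_le_log (by omega : 0 < N + 1) hM₂ le_rfl hk4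
  have hent : ∀ x a a' (i j : β × γ), ‖(co.encA x).1 a a' * k.2.1 x i j
      - (p.1 x : ℂ) * (ω x).1 (a, i) (a', j)‖ ≤ η := by
    rintro x a a' ⟨b, c⟩ ⟨b', c'⟩
    have h1 := (norm_apply_le_traceNorm _ (x, a, b, c) (x, a', b', c')).trans hco
    rw [Matrix.sub_apply, hkavg, extendedState_apply, if_pos rfl, if_pos rfl] at h1
    exact h1
  unfold extensionDefect
  have s1 : ∑ x, |k.1 x - p.1 x| = 0 := by simp [hk1]
  have s2 : ∑ x, ∑ a, ∑ a', ∑ i, ∑ j, ‖(co.encA x).1 a a' * k.2.1 x i j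
      - (p.1 x : ℂ) * (ω x).1 (a, i) (a', j)‖ ≤ D * η := by
    calc _ ≤ ∑ x : 𝒳, ∑ a : α, ∑ a' : α, ∑ i : β × γ, ∑ j : β × γ, η := by
          gcongr with x _ a _ a' _ i _ j _
          exact hent x a a' i j
      _ = D * η := by
          simp only [Finset.sum_const, Finset.card_univ, nsmul_eq_mul, hD]
          ring
  have s3 : max 0 (natEntropy p.1 - k.2.2.1 - R.1 * Real.log 2) ≤ 2 * η * Real.log 2 := by
    refine max_le (by positivity) ?_
    have := mul_le_mul_of_nonneg_right hd1 hl2.le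
    linarith
  have s4 : max 0 (natEntropy p.1 - k.2.2.2 - R.2 * Real.log 2) ≤ 2 * η * Real.log 2 := by
    refine max_le (by positivity) ?_
    have := mul_le_mul_of_nonneg_right hd2 hl2.le
    linarith
  have s5 : D * η + 4 * η * Real.log 2 = ε := by
    rw [hη]; field_simp
  simp only
  linarith

end CodeToPoint

end

end EmpiricalCoordination

theorem mainTheorem2 {𝒳 α β γ : Type*} [Fintype 𝒳] [DecidableEq 𝒳]
    [Fintype α] [DecidableEq α] [Fintype β] [DecidableEq β] [Fintype γ] [DecidableEq γ]
    (p : stdSimplex ℝ 𝒳) (ω : 𝒳 → EmpiricalCoordination.State (α × β × γ)) :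
    ((EmpiricalCoordination.cascadeExtensions p ω).Nonempty →
      EmpiricalCoordination.capacityRegion p ω =
        ⋃ σ ∈ EmpiricalCoordination.cascadeExtensions p ω,
          {R : ℝ × ℝ | σ.infoXYZ ≤ R.1 ∧ σ.infoXZ ≤ R.2}) ∧
    (EmpiricalCoordination.cascadeExtensions p ω = ∅ →
      ∀ R : ℝ × ℝ, ¬ EmpiricalCoordination.Achievable p ω R) := by
  refine ⟨fun _ => ?_, fun hempty R hR => ?_⟩
  · ext R
    simp only [Set.mem_iUnion, Set.mem_ofPred_eq, exists_prop]
    constructor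
    · exact EmpiricalCoordination.exists_extension_of_mem_capacityRegion
    · rintro ⟨σ, hσ, h₁, h₂⟩
      exact subset_closure (EmpiricalCoordination.achievable_of_mem_cascadeExtensions hσ h₁ h₂)
  · obtain ⟨σ, hσ, -⟩ :=
      EmpiricalCoordination.exists_extension_of_mem_capacityRegion (subset_closure hR)
    rw [hempty] at hσ
    exact hσ
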